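/- Work over $\mathbb{Q}$. All representations of symmetric groups are finite-dimensional, and $S_n\subset S_{n+1}$ is the subgroup fixing $n+1$. For a partition $\mu$ of $n$ let $V_\mu$ be the corresponding irreducible representation of $S_n$. For a partition $\lambda=(\lambda_1,\dots,\lambda_k)$ (possibly empty, in which case $|\lambda|=\lambda_1=0$) and $n\ge 1$ with $n\geq |\lambda|+\lambda_1$, put $V(\lambda)_n:=V_{(n-|\lambda|,\lambda_1,\dots,\lambda_k)}$. A consistent sequence $A=\{A(n),\phi_n\}$ consists of a representation $A(n)$ of $S_n$ for each $n\geq 1$ and $S_n$-equivariant maps $\phi_n\colon A(n)\to \mathrm{Res}\,A(n+1)$. It is representation stable at $N$ if for all $n\geq \max(N,1)$: (1) $\phi_n$ is injective; (2) $A(n+1)=\mathbb{Q}[S_{n+1}]\cdot\phi_n(A(n))$; (3) for each partition $\lambda$ with $|\lambda|+\lambda_1\le n+1$, the multiplicity of $V(\lambda)_{n+1}$ in $A(n+1)$ equals the multiplicity of $V(\lambda)_n$ in $A(n)$ if $|\lambda|+\lambda_1\le n$, and equals $0$ if $|\lambda|+\lambda_1=n+1$. A consistent sequence of chain complexes consists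 of a chain complex $A(n)=(A(n)_i)_{i\in\mathbb{Z}}$ of representations of $S_n$ for each $n\geq 1$ and $S_n$-equivariant chain maps $\phi_n\colon A(n)\to \mathrm{Res}\,A(n+1)$. It is representation stable at $N$ if for every degree $i$ the consistent sequence $\{A(n)_i,\phi_{n,i}\}$ is representation stable at $N$. It stabilizes sharply at the natural number $N$ if it is representation stable at $N$ and is not representation stable at $N-1$ (the latter condition being void for $N=0$). **Theorem.** Let $\{A(n),\phi_n\}$ be a consistent sequence of chain complexes of symmetric group representations which is representation stable and stabilizes sharply at $N$, and let $\lambda=(\lambda_1,\dots,\lambda_k)$ be a partition with $|\lambda|+\lambda_1=N$. Then for each degree $i$, the multiplicity of $V(\lambda)_n$ in $H_i(A(n))$ is the same for all $n\geq N$ (with $n \geq 1$). -/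

import Mathlib

open CategoryTheory

universe u

noncomputable section

namespace RepStab

/-- A partition: a finite non-increasing sequence of positive integers (possibly empty).
For a partition `lam`, its size `|lam|` is `lam.sum`, and its first entry (read as `0` when
`lam` is empty) is `lam.headD 0`. -/
def IsPartition (lam : List ℕ) : Prop :=
  lam.SortedGE ∧ ∀ a ∈ lam, 0 < a

/-- The boxes of the Young diagram with row lengths `lam`, read row by row: `box lam j` is the pair
(row, column) of the `j`-th box; everything is counted from `0`.
Only the values at `j < lam.sum` matter. -/
def box : List ℕ → ℕ → ℕ × ℕ
  | [], j => (0, j)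
  | a :: lam, j => if j < a then (0, j) else ((box lam (j - a)).1 + 1, (box lam (j - a)).2)

/-- The Young symmetrizer `(∑_{g ∈ P} g) * (∑_{g ∈ Q} sgn(g) g)` of a tableau, given by the map `T`
that sends each label to its box (row, column): `P` is the group of permutations of the labels which
preserve each row, `Q` the group of those which preserve each column. -/
def youngSymmetrizer {α : Type} [Fintype α] [DecidableEq α] (T : α → ℕ × ℕ) :
    MonoidAlgebra ℚ (Equiv.Perm α) :=
  (∑ g : Equiv.Perm α with ∀ j, (T (g j)).1 = (T j).1, MonoidAlgebra.single g 1) *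
  (∑ g : Equiv.Perm α with ∀ j, (T (g j)).2 = (T j).2,
    MonoidAlgebra.single g ((Equiv.Perm.sign g : ℤ) : ℚ))

/-- The left ideal of the rational group algebra generated by the Young symmetrizer of the tableau
of shape `lam` whose labels are written row by row. -/
abbrev spechtIdeal (lam : List ℕ) (n : ℕ) : Ideal (MonoidAlgebra ℚ (Equiv.Perm (Fin n))) :=
  Ideal.span {youngSymmetrizer fun j : Fin n => box lam j}

/-- The irreducible representation `V_lam` of `S_n`, for a partition `lam` of `n`. -/
def specht (lam : List ℕ) (n : ℕ) :
    Representation ℚ (Equiv.Perm (Fin n)) (spechtIdeal lam n) :=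
  Representation.ofModule' (spechtIdeal lam n)

/-- The representation `V(lam)_n = V_{(n - |lam|, lam_1, ..., lam_k)}` of `S_n`;
meaningful when `|lam| + lam_1 ≤ n`. -/
abbrev padded (lam : List ℕ) (n : ℕ) :
    Representation ℚ (Equiv.Perm (Fin n)) (spechtIdeal ((n - lam.sum) :: lam) n) :=
  specht ((n - lam.sum) :: lam) n

/-- The multiplicity of `V(lam)_n` in a finite-dimensional representation `W` of `S_n`, that is,
`dim Hom_{S_n}(V(lam)_n, W)`. (The irreducible representations of symmetric groups over `ℚ` are
absolutely irreducible, so this is the number of copies of `V(lam)_n` in a decomposition of `W`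
into irreducible representations.) -/
def mult (lam : List ℕ) (n : ℕ) (W : Rep.{u} ℚ (Equiv.Perm (Fin n))) : ℕ :=
  Module.finrank ℚ ((padded lam n).IntertwiningMap W.ρ)

/-- The usual inclusion `S_n ⊂ S_{n+1}` as the permutations which fix the last label. -/
def incl (n : ℕ) : Equiv.Perm (Fin n) →* Equiv.Perm (Fin (n + 1)) :=
  Equiv.Perm.viaEmbeddingHom Fin.castSuccEmb

/-- A consistent sequence of (finite-dimensional, rational) symmetric group representations.
Only the terms with `n ≥ 1` are ever used; the term at `n = 0` is irrelevant. -/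
structure ConsistentSequence where
  /-- the representation `A(n)` of `S_n` -/
  obj : ∀ n : ℕ, Rep.{u} ℚ (Equiv.Perm (Fin n))
  finiteDimensional : ∀ n, FiniteDimensional ℚ (obj n)
  /-- the equivariant map `φ_n : A(n) → Res A(n+1)` -/
  map : ∀ n : ℕ, obj n ⟶ Rep.res (incl n) (obj (n + 1))

/-- (Uniform) representation stability at `N` of a consistent sequence. -/
def ConsistentSequence.StableAt (A : ConsistentSequence.{u}) (N : ℕ) : Prop :=
  ∀ n : ℕ, 1 ≤ n → N ≤ n →
    -- the map `φ_n` is injective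
    Function.Injective (A.map n).hom ∧
    -- its image generates `A(n+1)` as a representation of `S_{n+1}`
    Submodule.span ℚ
      {y : A.obj (n + 1) | ∃ (g : Equiv.Perm (Fin (n + 1))) (x : A.obj n),
        y = (A.obj (n + 1)).ρ g ((A.map n).hom x)} = ⊤ ∧
    -- each `V(lam)_{n+1}` that is defined appears in `A(n+1)` as often as `V(lam)_n` does in `A(n)`,
    -- and not at all if `V(lam)_n` is not defined
    ∀ lam : List ℕ, IsPartition lam → lam.sum + lam.headD 0 ≤ n + 1 →
      mult lam (n + 1) (A.obj (n + 1)) =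
        if lam.sum + lam.headD 0 ≤ n then mult lam n (A.obj n) else 0

/-- A consistent sequence of symmetric group representations in the category of chain complexes,
of finite dimension in each degree.
Only the terms with `n ≥ 1` are ever used; the term at `n = 0` is irrelevant. -/
structure ConsistentComplex where
  /-- the chain complex `A(n)` of representations of `S_n` -/
  obj : ∀ n : ℕ, ChainComplex (Rep.{u} ℚ (Equiv.Perm (Fin n))) ℤ
  finiteDimensional : ∀ n i, FiniteDimensional ℚ ((obj n).X i)
  /-- the equivariant chain map `φ_n : A(n) → Res A(n+1)` -/
  map : ∀ n : ℕ, obj n ⟶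
    ((Rep.resFunctor (incl n)).mapHomologicalComplex (ComplexShape.down ℤ)).obj (obj (n + 1))

/-- The consistent sequence of representations formed by the terms of degree `i`. -/
def ConsistentComplex.degree (A : ConsistentComplex.{u}) (i : ℤ) : ConsistentSequence.{u} where
  obj n := (A.obj n).X i
  finiteDimensional n := A.finiteDimensional n i
  map n := (A.map n).f i

/-- Representation stability at `N` of a consistent sequence of chain complexes: in each degree. -/
def ConsistentComplex.StableAt (A : ConsistentComplex.{u}) (N : ℕ) : Prop :=
  ∀ i : ℤ, (A.degree i).StableAt N

/-- `A` is representation stable at `N` and not at `N - 1` (the latter is void if `N = 0`). -/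
def ConsistentComplex.StabilizesSharplyAt (A : ConsistentComplex.{u}) (N : ℕ) : Prop :=
  A.StableAt N ∧ ∀ M : ℕ, M + 1 = N → ¬ A.StableAt M

end RepStab

end

/-!
The multiplicity of `V(lam)_n` in a representation `W` of `S_n` is the dimension of `e W`, where `e`
is the Young symmetrizer generating `V(lam)_n` (`mult_eq`), and `W ↦ e W` is exact because the group
algebra is von Neumann regular (`exists_eq_mul_mul`, `cut_inf_range`). So the multiplicity in
homology is determined by the multiplicities in the terms of the complex and by the ranks of the
differentials on the spaces `e A(n)_i` (`finrank_cut_homology`). It remains to identify these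
spaces for `n` and `n + 1` compatibly with the differentials.

Write `a = n - |lam|`. The Young symmetrizer of the shape `(a + 1, lam)` is obtained from that of
`(a, lam)` by multiplication with a fixed sum of coset representatives: the new label sits at the
end of the first row, alone in its column. Composing `φ_n` with this sum (and a relabelling) maps
`e_n A(n)_i` to `e_{n+1} A(n+1)_i`, naturally in `A`. By stability both spaces have the same
dimension, so injectivity is enough (`exists_transfer`, `finrank_map_d_succ`). This is where
`|lam| + lam_1 = N` enters: if `|κ| = |lam| + 1` and `κ_1 ≥ lam_1`, then `|κ| + κ_1 > N`, and so
`V(κ)_{n+1}` does not occur in `A(n+1)_i` by stability.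

Injectivity is `rowSum_colSum_eq_zero`. It replaces the branching rule by an argument in the
style of highest weights. Call a vector *highest* for a set `F` of labels if it is invariant under
the permutations of `F`, and killed by the symmetrization over `F` and any one further label. If
`v` is highest for `F`, and the dual Young symmetrizer of a tableau on the other labels does not
kill `v`, then neither does that of the tableau with `F` added as a new first row
(`exists_tableau_cons`). The reason is positivity with respect to an invariant inner product: the
pairing of `v` with its column antisymmetrization expands into nonnegative multiples of squared
norms of symmetrizations of `v` (`exists_form_pairPerm`, `form_colSum_pos`). By induction, no
nonzero vector is killed by all dual Young symmetrizers (`exists_tableau_ne_zero`). Now a vector in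
the kernel of the map above is highest for the first row `F` of `(a, lam)`. If it were nonzero, some
shape `κ` on the complement of `F` would not kill it. Here `κ` is as in the previous paragraph by
the pigeonhole principle, and a count of transpositions gives `κ_1 ≤ a`. So `(a, κ)` is a partition
that does not kill the vector either, a contradiction.
-/

noncomputable section

namespace RepStab

/-! ### Sums over the stabilizer of a colouring -/

section StabilizerSums

variable {α : Type} [Fintype α] [DecidableEq α] {ι : Type*} [DecidableEq ι]
  {V : Type*} [AddCommGroup V] [Module ℚ V]

/-- The permutations which preserve the fibres of the colouring `c` and fix `S` pointwise. -/
def colorStab (c : α → ι) (S : Finset α) : Finset (Equiv.Perm α) :=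
  Finset.univ.filter fun g => (∀ j, c (g j) = c j) ∧ ∀ s ∈ S, g s = s

lemma mem_colorStab {c : α → ι} {S : Finset α} {g : Equiv.Perm α} :
    g ∈ colorStab c S ↔ (∀ j, c (g j) = c j) ∧ ∀ s ∈ S, g s = s := by
  simp [colorStab]

lemma one_mem_colorStab (c : α → ι) (S : Finset α) : 1 ∈ colorStab c S := by
  simp [mem_colorStab]

lemma mul_mem_colorStab {c : α → ι} {S : Finset α} {g h : Equiv.Perm α}
    (hg : g ∈ colorStab c S) (hh : h ∈ colorStab c S) : g * h ∈ colorStab c S := by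
  rw [mem_colorStab] at *
  refine ⟨fun j => by simp [hg.1, hh.1], fun s hs => by simp [hh.2 s hs, hg.2 s hs]⟩

lemma inv_mem_colorStab {c : α → ι} {S : Finset α} {g : Equiv.Perm α}
    (hg : g ∈ colorStab c S) : g⁻¹ ∈ colorStab c S := by
  rw [mem_colorStab] at *
  refine ⟨fun j => ?_, fun s hs => ?_⟩
  · simpa using (hg.1 (g⁻¹ j)).symm
  · rw [Equiv.Perm.inv_eq_iff_eq, hg.2 s hs]

lemma swap_mem_colorStab {c : α → ι} {S : Finset α} {x y : α} (h : c x = c y)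
    (hx : x ∉ S) (hy : y ∉ S) : Equiv.swap x y ∈ colorStab c S := by
  rw [mem_colorStab]
  refine ⟨fun j => ?_, fun s hs => Equiv.swap_apply_of_ne_of_ne ?_ ?_⟩
  · rcases eq_or_ne j x with rfl | h1
    · simp [h]
    rcases eq_or_ne j y with rfl | h2
    · simp [h]
    rw [Equiv.swap_apply_of_ne_of_ne h1 h2]
  · rintro rfl; exact hx hs
  · rintro rfl; exact hy hs

lemma colorStab_mono {c : α → ι} {S S' : Finset α} (h : S ⊆ S') :
    colorStab c S' ⊆ colorStab c S := fun g hg => by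
  rw [mem_colorStab] at *
  exact ⟨hg.1, fun s hs => hg.2 s (h hs)⟩

/-- Coset decomposition of a colour stabilizer with respect to the stabilizer of one more
point `x`: the transpositions `(x y)`, with `y` in the orbit of `x`, represent the cosets. -/
lemma sum_colorStab {M : Type*} [AddCommMonoid M] (c : α → ι) {S : Finset α} {x : α} (hx : x ∉ S)
    (f : Equiv.Perm α → M) :
    ∑ g ∈ colorStab c S, f g = ∑ y with c y = c x ∧ y ∉ S,
      ∑ g ∈ colorStab c (insert x S), f (Equiv.swap x y * g) := by
  rw [← Finset.sum_product']
  symm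
  refine Finset.sum_bij' (fun p _ => Equiv.swap x p.1 * p.2)
    (fun g _ => (g x, Equiv.swap x (g x) * g)) ?_ ?_ ?_ ?_ ?_
  · rintro ⟨y, g⟩ h
    simp only [Finset.mem_product, Finset.mem_filter, Finset.mem_univ, true_and] at h
    exact mul_mem_colorStab (swap_mem_colorStab h.1.1.symm hx h.1.2)
      (colorStab_mono (Finset.subset_insert x S) h.2)
  · intro g hg
    have hgx : g x ∉ S := fun h => hx (by
      have := (mem_colorStab.1 (inv_mem_colorStab hg)).2 _ h
      rw [Equiv.Perm.inv_eq_iff_eq] at this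
      rwa [← g.injective this] at h)
    have hc := (mem_colorStab.1 hg).1 x
    simp only [Finset.mem_product, Finset.mem_filter, Finset.mem_univ, true_and]
    refine ⟨⟨hc, hgx⟩, ?_⟩
    have h1 := mem_colorStab.1 (mul_mem_colorStab (swap_mem_colorStab hc.symm hx hgx) hg)
    rw [mem_colorStab]
    refine ⟨h1.1, fun s hs => ?_⟩
    rcases Finset.mem_insert.1 hs with rfl | hs
    · simp
    · exact h1.2 s hs
  · rintro ⟨y, g⟩ h
    simp only [Finset.mem_product, Finset.mem_filter, Finset.mem_univ, true_and] at h
    have : g x = x := (mem_colorStab.1 h.2).2 x (Finset.mem_insert_self _ _)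
    simp [this]
  · intro g hg
    simp
  · intro p hp
    rfl

lemma sum_colorStab_inv {M : Type*} [AddCommMonoid M] (c : α → ι) (S : Finset α)
    (f : Equiv.Perm α → M) :
    ∑ g ∈ colorStab c S, f g⁻¹ = ∑ g ∈ colorStab c S, f g :=
  Finset.sum_bij' (fun g _ => g⁻¹) (fun g _ => g⁻¹) (fun _ => inv_mem_colorStab)
    (fun _ => inv_mem_colorStab) (by simp) (by simp) (by simp)

/-- The version of `sum_colorStab` for cosets on the other side. -/
lemma sum_colorStab_right {M : Type*} [AddCommMonoid M] (c : α → ι) {S : Finset α} {x : α}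
    (hx : x ∉ S) (f : Equiv.Perm α → M) :
    ∑ g ∈ colorStab c S, f g = ∑ y with c y = c x ∧ y ∉ S,
      ∑ g ∈ colorStab c (insert x S), f (g * Equiv.swap x y) := by
  rw [← sum_colorStab_inv, sum_colorStab c hx]
  refine Finset.sum_congr rfl fun y _ => ?_
  rw [← sum_colorStab_inv]
  simp

/-- The sum `∑ χ(g) g` over a colour stabilizer, acting on a representation. For trivial `χ` this
is a symmetrizer, for `χ = sign` an antisymmetrizer. -/
def stabSum (ρ : Representation ℚ (Equiv.Perm α) V) (χ : Equiv.Perm α →* ℤˣ) (c : α → ι)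
    (S : Finset α) : V →ₗ[ℚ] V :=
  ∑ g ∈ colorStab c S, ((χ g : ℤ) : ℚ) • ρ g

variable {ρ : Representation ℚ (Equiv.Perm α) V} {χ : Equiv.Perm α →* ℤˣ} {c : α → ι}
  {S : Finset α}

lemma stabSum_apply (v : V) :
    stabSum ρ χ c S v = ∑ g ∈ colorStab c S, ((χ g : ℤ) : ℚ) • ρ g v := by
  simp [stabSum]

lemma unit_mul_self (e : ℤˣ) : (((e : ℤ) : ℚ)) * ((e : ℤ) : ℚ) = 1 := by
  rcases Int.units_eq_one_or e with rfl | rfl <;> simp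

omit [Fintype α] [DecidableEq α] in
lemma map_inv_unit (h : Equiv.Perm α) : χ h⁻¹ = χ h := by
  rw [map_inv, Int.units_inv_eq_self]

omit [Fintype α] [DecidableEq α] in
lemma rho_mul (g h : Equiv.Perm α) (v : V) : ρ g (ρ h v) = ρ (g * h) v := by simp

omit [Fintype α] [DecidableEq α] in
lemma rho_refl (v : V) : ρ (Equiv.refl α) v = v := by
  rw [← Equiv.Perm.one_def, map_one, Module.End.one_apply]

lemma rho_stabSum {h : Equiv.Perm α} (hh : h ∈ colorStab c S) (v : V) :
    ρ h (stabSum ρ χ c S v) = ((χ h : ℤ) : ℚ) • stabSum ρ χ c S v := by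
  simp only [stabSum_apply, map_sum, map_smul, Finset.smul_sum]
  refine Finset.sum_bij' (fun g _ => h * g) (fun g _ => h⁻¹ * g)
    (fun g hg => mul_mem_colorStab hh hg) (fun g hg => mul_mem_colorStab (inv_mem_colorStab hh) hg)
    (by simp) (by simp) fun g _ => ?_
  rw [smul_smul, rho_mul, map_mul χ, Units.val_mul, Int.cast_mul, ← mul_assoc,
    unit_mul_self, one_mul]

lemma stabSum_rho {h : Equiv.Perm α} (hh : h ∈ colorStab c S) (v : V) :
    stabSum ρ χ c S (ρ h v) = ((χ h : ℤ) : ℚ) • stabSum ρ χ c S v := by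
  simp only [stabSum_apply, Finset.smul_sum]
  refine Finset.sum_bij' (fun g _ => g * h) (fun g _ => g * h⁻¹)
    (fun g hg => mul_mem_colorStab hg hh) (fun g hg => mul_mem_colorStab hg (inv_mem_colorStab hh))
    (by simp) (by simp) fun g _ => ?_
  rw [smul_smul, rho_mul, map_mul χ, Units.val_mul, Int.cast_mul, mul_comm ((χ g : ℤ) : ℚ),
    ← mul_assoc, unit_mul_self, one_mul]

/-- A stabilizer sum absorbs, up to the order of the group, the sum over a subgroup. -/
lemma stabSum_stabSum {κ : Type*} [DecidableEq κ] {c' : α → κ} {S' : Finset α}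
    (h : colorStab c' S' ⊆ colorStab c S) (v : V) :
    stabSum ρ χ c S (stabSum ρ χ c' S' v) =
      ((colorStab c' S').card : ℚ) • stabSum ρ χ c S v := by
  rw [stabSum_apply (c := c'), map_sum, Finset.sum_congr rfl (g := fun _ => stabSum ρ χ c S v)]
  · rw [Finset.sum_const, Nat.cast_smul_eq_nsmul]
  · intro g hg
    rw [map_smul, stabSum_rho (h hg), smul_smul, unit_mul_self, one_smul]

lemma card_colorStab_pos (c : α → ι) (S : Finset α) : (0 : ℚ) < (colorStab c S).card := by
  exact_mod_cast Finset.card_pos.2 ⟨1, one_mem_colorStab c S⟩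

lemma stabSum_eq_smul {v : V} (h : ∀ g ∈ colorStab c S, ρ g v = ((χ g : ℤ) : ℚ) • v) :
    stabSum ρ χ c S v = ((colorStab c S).card : ℚ) • v := by
  rw [stabSum_apply, Finset.sum_congr rfl (g := fun _ => v)]
  · rw [Finset.sum_const, Nat.cast_smul_eq_nsmul]
  · intro g hg
    rw [h g hg, smul_smul, unit_mul_self, one_smul]

lemma eq_zero_of_eq_neg {v : V} (h : v = -v) : v = 0 := by
  have h2 : (2 : ℚ) • v = 0 := by
    rw [two_smul]; nth_rewrite 2 [h]; exact add_neg_cancel v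
  exact (smul_eq_zero.1 h2).resolve_left two_ne_zero

/-- If `g` conjugates a transposition in the column group into a transposition in the row group,
then the product of the symmetrizer, `g` and the antisymmetrizer vanishes. -/
lemma stabSum_rho_stabSum_eq_zero {κ : Type*} [DecidableEq κ] {r : α → κ} {S' : Finset α}
    {g : Equiv.Perm α} {x x' : α} (hne : x ≠ x') (hr : r (g x) = r (g x')) (hgx : g x ∉ S')
    (hgx' : g x' ∉ S') (hc : c x = c x') (hx : x ∉ S) (hx' : x' ∉ S) (v : V) :
    stabSum ρ 1 r S' (ρ g (stabSum ρ Equiv.Perm.sign c S v)) = 0 := by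
  have h1 := stabSum_rho (ρ := ρ) (χ := 1) (swap_mem_colorStab hr hgx hgx')
    (ρ g (stabSum ρ Equiv.Perm.sign c S v))
  have h2 := rho_stabSum (ρ := ρ) (χ := Equiv.Perm.sign) (swap_mem_colorStab hc hx hx') v
  rw [rho_mul, ← Equiv.mul_swap_eq_swap_mul, ← rho_mul, h2, Equiv.Perm.sign_swap hne] at h1
  simp only [MonoidHom.one_apply, Units.val_one, Int.cast_one, one_smul, Units.val_neg,
    Int.cast_neg, neg_smul, map_neg] at h1
  exact eq_zero_of_eq_neg h1.symm

/-- Conjugation of a stabilizer sum by a permutation. -/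
lemma stabSum_comp (σ : Equiv.Perm α) (v : V) :
    stabSum ρ χ (fun x => c (σ x)) ∅ v = ρ σ⁻¹ (stabSum ρ χ c ∅ (ρ σ v)) := by
  simp only [stabSum_apply, map_sum, map_smul]
  refine Finset.sum_bij' (fun g _ => σ * g * σ⁻¹) (fun g _ => σ⁻¹ * g * σ) ?_ ?_ ?_ ?_ ?_
  · intro g hg
    simp only [mem_colorStab, Finset.notMem_empty, false_imp_iff, implies_true, and_true] at hg ⊢
    intro j
    simpa using hg (σ⁻¹ j)
  · intro g hg
    simp only [mem_colorStab, Finset.notMem_empty, false_imp_iff, implies_true, and_true] at hg ⊢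
    intro j
    simpa using hg (σ j)
  · intro g _; group
  · intro g _; group
  · intro g _
    have : χ (σ * g * σ⁻¹) = χ g := by
      rw [map_mul, map_mul, map_inv, mul_comm (χ σ), mul_inv_cancel_right]
    rw [this, rho_mul, rho_mul]
    congr 3
    group

end StabilizerSums

/-! ### Highest vectors and positivity -/

section Positivity

variable {α : Type} [Fintype α] [DecidableEq α] {ι : Type*} [DecidableEq ι]
  {V : Type*} [AddCommGroup V] [Module ℚ V]
  {ρ : Representation ℚ (Equiv.Perm α) V} {χ : Equiv.Perm α →* ℤˣ} {c : α → ι}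
  {S : Finset α}

/-- An invariant positive definite bilinear form (symmetry is not needed). -/
structure IsInvariantInner {G : Type*} [Group G] (ρ : Representation ℚ G V)
    (B : V →ₗ[ℚ] V →ₗ[ℚ] ℚ) : Prop where
  inv : ∀ g u w, B (ρ g u) (ρ g w) = B u w
  pos : ∀ u, u ≠ 0 → 0 < B u u

lemma exists_isInvariantInner {G : Type*} [Group G] [Fintype G] [FiniteDimensional ℚ V]
    (ρ : Representation ℚ G V) : ∃ B : V →ₗ[ℚ] V →ₗ[ℚ] ℚ, IsInvariantInner ρ B := by
  let b := Module.finBasis ℚ V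
  let φ : G → Fin (Module.finrank ℚ V) → V →ₗ[ℚ] ℚ := fun g i => b.coord i ∘ₗ ρ g
  have key : ∀ u w, (∑ g, ∑ i, (LinearMap.mul ℚ ℚ).compl₁₂ (φ g i) (φ g i)) u w =
      ∑ g, ∑ i, b.repr (ρ g u) i * b.repr (ρ g w) i := by
    intro u w
    simp [φ, LinearMap.sum_apply]
  refine ⟨∑ g, ∑ i, (LinearMap.mul ℚ ℚ).compl₁₂ (φ g i) (φ g i),
    ⟨fun g u w => ?_, fun u hu => ?_⟩⟩
  · rw [key, key]
    refine Fintype.sum_equiv (Equiv.mulRight g) _ _ fun h => ?_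
    simp
  · rw [key]
    obtain ⟨i, hi⟩ : ∃ i, b.repr u i ≠ 0 := by
      by_contra! h
      exact hu (b.repr.map_eq_zero_iff.1 (Finsupp.ext h))
    refine Finset.sum_pos' (fun g _ => Finset.sum_nonneg fun i _ => mul_self_nonneg _)
      ⟨1, Finset.mem_univ _, Finset.sum_pos' (fun i _ => mul_self_nonneg _)
        ⟨i, Finset.mem_univ _, ?_⟩⟩
    simpa using mul_self_pos.2 hi

lemma IsInvariantInner.nonneg {G : Type*} [Group G] {ρ : Representation ℚ G V}
    {B : V →ₗ[ℚ] V →ₗ[ℚ] ℚ} (hB : IsInvariantInner ρ B) (u : V) : 0 ≤ B u u := by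
  rcases eq_or_ne u 0 with rfl | h
  · simp
  · exact (hB.pos u h).le

lemma IsInvariantInner.apply_left {G : Type*} [Group G] {ρ : Representation ℚ G V}
    {B : V →ₗ[ℚ] V →ₗ[ℚ] ℚ} (hB : IsInvariantInner ρ B) (g : G) (u w : V) :
    B (ρ g u) w = B u (ρ g⁻¹ w) := by
  rw [← hB.inv g u, Representation.self_inv_apply]

variable {B : V →ₗ[ℚ] V →ₗ[ℚ] ℚ}

lemma IsInvariantInner.stabSum_left (hB : IsInvariantInner ρ B) (u w : V) :
    B (stabSum ρ χ c S u) w = B u (stabSum ρ χ c S w) := by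
  rw [stabSum_apply, stabSum_apply, map_sum, map_sum, LinearMap.sum_apply, ← sum_colorStab_inv]
  refine Finset.sum_congr rfl fun g _ => ?_
  rw [map_smul, map_smul, LinearMap.smul_apply, hB.apply_left, inv_inv, map_inv_unit]

lemma stabSum_peel {x : α} (hx : x ∉ S) (v : V) :
    stabSum ρ χ c S v = ∑ y with c y = c x ∧ y ∉ S,
      ((χ (Equiv.swap x y) : ℤ) : ℚ) • ρ (Equiv.swap x y) (stabSum ρ χ c (insert x S) v) := by
  rw [stabSum_apply, sum_colorStab c hx]
  refine Finset.sum_congr rfl fun y _ => ?_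
  rw [stabSum_apply, map_sum, Finset.smul_sum]
  refine Finset.sum_congr rfl fun g _ => ?_
  rw [map_smul, smul_smul, rho_mul, map_mul χ, Units.val_mul, Int.cast_mul]

lemma stabSum_peel_right {x : α} (hx : x ∉ S) (v : V) :
    stabSum ρ χ c S v = ∑ y with c y = c x ∧ y ∉ S,
      stabSum ρ χ c (insert x S) (((χ (Equiv.swap x y) : ℤ) : ℚ) • ρ (Equiv.swap x y) v) := by
  rw [stabSum_apply, sum_colorStab_right c hx]
  refine Finset.sum_congr rfl fun y _ => ?_
  rw [stabSum_apply]
  refine Finset.sum_congr rfl fun g _ => ?_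
  rw [map_smul, smul_smul, rho_mul, map_mul χ, Units.val_mul, Int.cast_mul]

/-- The sum of all permutations of the labels in `X`, acting on a representation. -/
abbrev setSym (ρ : Representation ℚ (Equiv.Perm α) V) (X : Finset α) : V →ₗ[ℚ] V :=
  stabSum ρ 1 (fun _ => ()) Xᶜ

lemma mem_setStab {X : Finset α} {g : Equiv.Perm α} :
    g ∈ colorStab (fun _ => ()) Xᶜ ↔ ∀ x ∉ X, g x = x := by
  simp [mem_colorStab]

lemma setSym_empty (v : V) : setSym ρ ∅ v = v := by
  have : colorStab (fun _ : α => ()) (∅ : Finset α)ᶜ = {1} := by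
    ext g
    rw [mem_setStab, Finset.mem_singleton]
    exact ⟨fun h => Equiv.ext fun x => h x (Finset.notMem_empty x), by rintro rfl; simp⟩
  rw [stabSum_apply, this]
  simp

lemma filter_insert_compl (X : Finset α) (j : α) :
    (Finset.univ.filter fun y : α => () = () ∧ y ∉ (insert j X)ᶜ) = insert j X := by
  ext; simp only [Finset.mem_filter, Finset.mem_univ, Finset.mem_compl, not_not, true_and]

lemma setSym_insert {X : Finset α} {j : α} (hj : j ∉ X) (v : V) :
    setSym ρ (insert j X) v = setSym ρ X v + ∑ x ∈ X, ρ (Equiv.swap j x) (setSym ρ X v) := by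
  have hS : insert j (insert j X)ᶜ = Xᶜ := by
    ext x; by_cases h : x = j <;> simp [h, hj]
  rw [setSym, stabSum_peel (x := j) (by simp), filter_insert_compl X j, Finset.sum_insert hj, hS]
  simp [rho_refl]

lemma setSym_insert_right {X : Finset α} {j : α} (hj : j ∉ X) (v : V) :
    setSym ρ (insert j X) v = setSym ρ X (v + ∑ x ∈ X, ρ (Equiv.swap j x) v) := by
  have hS : insert j (insert j X)ᶜ = Xᶜ := by
    ext x; by_cases h : x = j <;> simp [h, hj]
  rw [setSym, stabSum_peel_right (x := j) (by simp), filter_insert_compl X j, Finset.sum_insert hj,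
    hS, map_add, map_sum]
  simp [rho_refl]

/-- The vectors invariant under the permutations of the labels in `F` and killed by the
symmetrization over `insert j F` for every further label `j` (which is a multiple of the sum of `v`
and its images under the transpositions `(j i)` with `i ∈ F`). They play the role of highest weight
vectors: `F` is about to become the first row of a tableau, and no longer row is possible. -/
def highest (ρ : Representation ℚ (Equiv.Perm α) V) (F : Finset α) : Submodule ℚ V where
  carrier := {v | (∀ i ∈ F, ∀ i' ∈ F, ρ (Equiv.swap i i') v = v) ∧
    ∀ j ∉ F, v + ∑ i ∈ F, ρ (Equiv.swap j i) v = 0}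
  zero_mem' := by simp
  add_mem' := by
    rintro u v ⟨hu, hu'⟩ ⟨hv, hv'⟩
    refine ⟨fun i hi i' hi' => by rw [map_add, hu i hi i' hi', hv i hi i' hi'], fun j hj => ?_⟩
    simp only [map_add, Finset.sum_add_distrib]
    rw [add_add_add_comm, hu' j hj, hv' j hj, add_zero]
  smul_mem' := by
    rintro r v ⟨hv, hv'⟩
    refine ⟨fun i hi i' hi' => by rw [map_smul, hv i hi i' hi'], fun j hj => ?_⟩
    simp only [map_smul]
    rw [← Finset.smul_sum, ← smul_add, hv' j hj, smul_zero]

variable {F : Finset α} {v : V}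

omit [Fintype α] in
lemma mem_highest : v ∈ highest ρ F ↔ (∀ i ∈ F, ∀ i' ∈ F, ρ (Equiv.swap i i') v = v) ∧
    ∀ j ∉ F, v + ∑ i ∈ F, ρ (Equiv.swap j i) v = 0 := Iff.rfl

omit [Fintype α] in
lemma rho_mem_highest (hv : v ∈ highest ρ F) {g : Equiv.Perm α} (hg : ∀ x ∈ F, g x = x) :
    ρ g v ∈ highest ρ F := by
  rw [mem_highest] at *
  refine ⟨fun i hi i' hi' => ?_, fun j hj => ?_⟩
  · have := Equiv.mul_swap_eq_swap_mul g i i'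
    rw [hg i hi, hg i' hi'] at this
    rw [rho_mul, ← this, ← rho_mul, hv.1 i hi i' hi']
  · have hj' : g⁻¹ j ∉ F := fun h => hj (by
      have := hg _ h
      rw [show g (g⁻¹ j) = j from g.apply_symm_apply j] at this
      rwa [this])
    rw [← map_zero (ρ g), ← hv.2 _ hj', map_add, map_sum]
    congr 1
    refine Finset.sum_congr rfl fun i hi => ?_
    have := Equiv.mul_swap_eq_swap_mul g (g⁻¹ j) i
    rw [hg i hi, show g (g⁻¹ j) = j from g.apply_symm_apply j] at this
    rw [rho_mul, rho_mul, this]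

lemma stabSum_mem_highest (hv : v ∈ highest ρ F) : stabSum ρ χ c F v ∈ highest ρ F := by
  rw [stabSum_apply]
  exact Submodule.sum_mem _ fun g hg => Submodule.smul_mem _ _
    (rho_mem_highest hv (mem_colorStab.1 hg).2)

/-- The product of the transpositions given by a list of pairs. -/
def pairPerm : List (α × α) → Equiv.Perm α
  | [] => 1
  | p :: l => pairPerm l * Equiv.swap p.1 p.2

/-- A list of disjoint pairs, each with its first entry in `F` and its second entry outside. -/
def IsMatching (F : Finset α) (l : List (α × α)) : Prop :=
  (l.map Prod.fst).Nodup ∧ (l.map Prod.snd).Nodup ∧ ∀ p ∈ l, p.1 ∈ F ∧ p.2 ∉ F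

omit [Fintype α] in
lemma pairPerm_apply_of_notMem {x : α} : ∀ l : List (α × α), x ∉ l.map Prod.fst →
    x ∉ l.map Prod.snd → pairPerm l x = x
  | [], _, _ => rfl
  | p :: l, h1, h2 => by
    rw [List.map_cons, List.mem_cons, not_or] at h1 h2
    rw [pairPerm, Equiv.Perm.mul_apply, Equiv.swap_apply_of_ne_of_ne h1.1 h2.1,
      pairPerm_apply_of_notMem l h1.2 h2.2]

omit [Fintype α] [DecidableEq α] in
lemma IsMatching.of_cons {p : α × α} {l : List (α × α)} (h : IsMatching F (p :: l)) :
    IsMatching F l :=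
  ⟨(List.nodup_cons.1 h.1).2, (List.nodup_cons.1 h.2.1).2,
    fun q hq => h.2.2 q (List.mem_cons_of_mem _ hq)⟩

omit [Fintype α] [DecidableEq α] in
lemma IsMatching.notMem_fst {l : List (α × α)} (h : IsMatching F l) {j : α} (hj : j ∉ F) :
    j ∉ l.map Prod.fst := by
  intro hm
  obtain ⟨q, hq, rfl⟩ := List.mem_map.1 hm
  exact hj (h.2.2 q hq).1

omit [Fintype α] [DecidableEq α] in
lemma IsMatching.notMem_snd {l : List (α × α)} (h : IsMatching F l) {j : α} (hj : j ∈ F) :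
    j ∉ l.map Prod.snd := by
  intro hm
  obtain ⟨q, hq, rfl⟩ := List.mem_map.1 hm
  exact (h.2.2 q hq).2 hj

omit [Fintype α] in
lemma pairPerm_apply_fst : ∀ l : List (α × α), IsMatching F l →
    ∀ p ∈ l, pairPerm l p.1 = p.2
  | [], _, p, hp => by simp at hp
  | q :: l, h, p, hp => by
    rw [pairPerm, Equiv.Perm.mul_apply]
    rcases List.mem_cons.1 hp with rfl | hp
    · rw [Equiv.swap_apply_left]
      exact pairPerm_apply_of_notMem l
        (h.of_cons.notMem_fst (h.2.2 p List.mem_cons_self).2) (List.nodup_cons.1 h.2.1).1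
    · have h1 : p.1 ≠ q.1 := fun e => (List.nodup_cons.1 h.1).1
        (List.mem_map.2 ⟨p, hp, e⟩)
      have h2 : p.1 ≠ q.2 := fun e => (h.2.2 q List.mem_cons_self).2
        (e ▸ (h.of_cons.2.2 p hp).1)
      rw [Equiv.swap_apply_of_ne_of_ne h1 h2]
      exact pairPerm_apply_fst l h.of_cons p hp

/-- Against vectors `u` invariant under permutations of `F`, a product of `k` disjoint
transpositions between `F` and its complement acts on a highest vector as a positive multiple of
`(-1) ^ k` times the symmetrization over the `k` labels outside `F`.

By invariance the partner in `F` of a given label may be averaged over the unused elements of `F`;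
the defining relation of `highest` turns this average into transpositions of labels outside `F`,
which are the coset representatives that enlarge the symmetrization by one label. -/
lemma exists_form_pairPerm (hB : IsInvariantInner ρ B) (hv : v ∈ highest ρ F) :
    ∀ l : List (α × α), IsMatching F l → ∃ C : ℚ, 0 < C ∧ ∀ u : V,
      (∀ i ∈ F, ∀ i' ∈ F, ρ (Equiv.swap i i') u = u) →
      B (ρ (pairPerm l) v) u =
        (-1) ^ l.length * C * B v (setSym ρ (l.map Prod.snd).toFinset u)
  | [], _ => ⟨1, one_pos, fun u _ => by
      rw [List.map_nil, List.toFinset_nil, setSym_empty]; simp [pairPerm]⟩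
  | (i, j) :: l, h => by
    obtain ⟨C, hC, IH⟩ := exists_form_pairPerm hB hv l h.of_cons
    obtain ⟨hi, hj⟩ : i ∈ F ∧ j ∉ F := h.2.2 _ List.mem_cons_self
    have hil : i ∉ l.map Prod.fst := (List.nodup_cons.1 h.1).1
    have hjl : j ∉ l.map Prod.snd := (List.nodup_cons.1 h.2.1).1
    set τ := pairPerm l with hτ
    have hτj : τ j = j := pairPerm_apply_of_notMem l (h.of_cons.notMem_fst hj) hjl
    set D := F \ (l.map Prod.fst).toFinset with hD
    have hiD : i ∈ D := by simp only [hD, Finset.mem_sdiff, List.mem_toFinset]; exact ⟨hi, hil⟩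
    have hDpos : (0 : ℚ) < D.card := by exact_mod_cast Finset.card_pos.2 ⟨i, hiD⟩
    refine ⟨C / D.card, by positivity, fun u hu => ?_⟩
    set J := (l.map Prod.snd).toFinset with hJ
    have hjJ : j ∉ J := by simpa [hJ] using hjl
    set u' := u + ∑ x ∈ J, ρ (Equiv.swap j x) u with hu'
    have hJF : ∀ x ∈ J, x ∉ F := by
      intro x hx hxF
      exact h.of_cons.notMem_snd hxF (List.mem_toFinset.1 hx)
    have hinv : ∀ i ∈ F, ∀ i' ∈ F, ρ (Equiv.swap i i') u' = u' := by
      intro k hk k' hk'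
      rw [hu', map_add, hu k hk k' hk', map_sum]
      congr 1
      refine Finset.sum_congr rfl fun x hx => ?_
      have hne : ∀ z ∉ F, Equiv.swap k k' z = z := fun z hz =>
        Equiv.swap_apply_of_ne_of_ne (by rintro rfl; exact hz hk) (by rintro rfl; exact hz hk')
      rw [rho_mul, Equiv.mul_swap_eq_swap_mul, hne j hj, hne x (hJF x hx), ← rho_mul,
        hu k hk k' hk']
    -- the value does not depend on the choice of the partner of `j`
    have hindep : ∀ k ∈ D, B (ρ τ (ρ (Equiv.swap j k) v)) u = B (ρ τ (ρ (Equiv.swap i j) v)) u := by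
      intro k hk
      simp only [hD, Finset.mem_sdiff, List.mem_toFinset] at hk
      have hτi : τ i = i := pairPerm_apply_of_notMem l hil (h.of_cons.notMem_snd hi)
      have hτk : τ k = k := pairPerm_apply_of_notMem l hk.2 (h.of_cons.notMem_snd hk.1)
      have hsj : Equiv.swap i k j = j := Equiv.swap_apply_of_ne_of_ne
        (by rintro rfl; exact hj hi) (by rintro rfl; exact hj hk.1)
      have e1 : τ * Equiv.swap j k * Equiv.swap i k = Equiv.swap i k * (τ * Equiv.swap i j) := by
        rw [← mul_assoc, show Equiv.swap i k * τ = τ * Equiv.swap i k by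
          rw [Equiv.mul_swap_eq_swap_mul, hτi, hτk], mul_assoc, mul_assoc,
          Equiv.mul_swap_eq_swap_mul (Equiv.swap i k) i j, hsj, Equiv.swap_apply_left,
          Equiv.swap_comm j k]
      have e2 := hv.1 i hi k hk.1
      rw [← hB.inv (Equiv.swap i k) (ρ τ (ρ (Equiv.swap i j) v)), hu i hi k hk.1, rho_mul, rho_mul,
        rho_mul, mul_assoc, ← e1, ← rho_mul _ (Equiv.swap i k), e2]
    -- the labels of `F` already paired in `l` are moved by `τ` to labels outside `F`
    have hpart : ∑ k ∈ (l.map Prod.fst).toFinset, B (ρ τ (ρ (Equiv.swap j k) v)) u =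
        ∑ x ∈ J, B (ρ τ v) (ρ (Equiv.swap j x) u) := by
      rw [List.sum_toFinset _ h.of_cons.1, hJ, List.sum_toFinset _ h.of_cons.2.1, List.map_map,
        List.map_map]
      congr 1
      refine List.map_congr_left fun p hp => ?_
      have := pairPerm_apply_fst l h.of_cons p hp
      simp only [Function.comp]
      rw [rho_mul, Equiv.mul_swap_eq_swap_mul, hτj, hτ, this, ← rho_mul, hB.apply_left,
        Equiv.swap_inv]
    have hzero : B (ρ τ (v + ∑ k ∈ F, ρ (Equiv.swap j k) v)) u = 0 := by
      rw [hv.2 j hj]; simp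
    have hsub : (l.map Prod.fst).toFinset ⊆ F := by
      intro x hx
      by_contra hxF
      exact h.of_cons.notMem_fst hxF (List.mem_toFinset.1 hx)
    rw [map_add, map_sum, map_add, map_sum, LinearMap.add_apply, LinearMap.sum_apply,
      ← Finset.sum_sdiff hsub, hpart, Finset.sum_congr rfl hindep, Finset.sum_const] at hzero
    have hIH := IH u' hinv
    rw [← setSym_insert_right hjJ, hu', map_add, map_sum] at hIH
    rw [show pairPerm ((i, j) :: l) = τ * Equiv.swap i j from rfl, ← rho_mul]
    simp only [List.map_cons, List.toFinset_cons, List.length_cons, pow_succ]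
    rw [nsmul_eq_mul] at hzero
    have : (D.card : ℚ) * B (ρ τ (ρ (Equiv.swap i j) v)) u =
        -((-1) ^ l.length * C * B v (setSym ρ (insert j J) u)) := by
      linear_combination hzero - hIH
    field_simp
    linear_combination this

lemma form_pairPerm_nonneg (hB : IsInvariantInner ρ B) (hv : v ∈ highest ρ F)
    {l : List (α × α)} (hl : IsMatching F l) : 0 ≤ (-1) ^ l.length * B (ρ (pairPerm l) v) v := by
  obtain ⟨C, hC, h⟩ := exists_form_pairPerm hB hv l hl
  rw [h v hv.1, ← mul_assoc, ← mul_assoc, ← mul_pow, neg_one_mul, neg_neg, one_pow, one_mul]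
  refine mul_nonneg hC.le ?_
  -- a symmetrization is self-adjoint, and is its own square up to a positive factor
  set J := (l.map Prod.snd).toFinset
  have h1 := hB.nonneg (setSym ρ J v)
  rw [hB.stabSum_left, stabSum_stabSum subset_rfl, map_smul, smul_eq_mul] at h1
  exact nonneg_of_mul_nonneg_right h1 (card_colorStab_pos _ _)

/-- Let `v ≠ 0` be a highest vector for `F` on which the column group of the remaining labels acts
by the sign. Then the full column antisymmetrizer does not kill `v`, if the labels in `F` lie
in different columns: peeling off the labels in `F` one by one expands `⟨b v, v⟩` into
positive multiples of terms `(-1) ^ k ⟨τ v, v⟩ ≥ 0`, and the term of the identity is positive. -/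
lemma form_colSum_pos (hB : IsInvariantInner ρ B) (hv : v ∈ highest ρ F) (hv0 : v ≠ 0)
    (hc : ∀ x ∈ F, ∀ y ∈ F, c x = c y → x = y)
    (hanti : ∀ g ∈ colorStab c F, ρ g v = ((Equiv.Perm.sign g : ℤ) : ℚ) • v) :
    0 < B (stabSum ρ Equiv.Perm.sign c ∅ v) v := by
  have hbase : stabSum ρ Equiv.Perm.sign c F v = ((colorStab c F).card : ℚ) • v :=
    stabSum_eq_smul hanti
  have hS : ∀ {x : α} {R : Finset α}, x ∈ F → x ∉ R → insert x (F \ insert x R) = F \ R := by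
    intro x R hx hR
    ext z
    by_cases h : z = x
    · subst h; simp [hx, hR]
    · simp [h]
  -- `R` holds the labels of `F` still to be peeled off, `l` the transpositions chosen so far
  have nonneg : ∀ R : Finset α, R ⊆ F → ∀ l : List (α × α), IsMatching F l →
      (∀ p ∈ l, p.1 ∉ R ∧ c p.1 = c p.2) →
      0 ≤ (-1) ^ l.length * B (ρ (pairPerm l) (stabSum ρ Equiv.Perm.sign c (F \ R) v)) v := by
    intro R
    induction R using Finset.induction_on with
    | empty =>
      intro _ l hl _
      rw [Finset.sdiff_empty, hbase, map_smul, map_smul, LinearMap.smul_apply, smul_eq_mul,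
        mul_left_comm]
      exact mul_nonneg (card_colorStab_pos _ _).le (form_pairPerm_nonneg hB hv hl)
    | insert x R hxR IH =>
      intro hRF l hl hlR
      obtain ⟨hxF, hRF'⟩ := Finset.insert_subset_iff.1 hRF
      have hlR' : ∀ p ∈ l, p.1 ∉ R ∧ c p.1 = c p.2 := fun p hp =>
        ⟨fun h => (hlR p hp).1 (Finset.mem_insert_of_mem h), (hlR p hp).2⟩
      rw [stabSum_peel (x := x) (by simp), hS hxF hxR, map_sum, map_sum, LinearMap.sum_apply,
        Finset.mul_sum]
      refine Finset.sum_nonneg fun y hy => ?_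
      simp only [Finset.mem_filter, Finset.mem_univ, true_and] at hy
      by_cases hyF : y ∈ F
      · obtain rfl := hc y hyF x hxF hy.1
        simpa [rho_refl] using IH hRF' l hl hlR'
      · have hne : x ≠ y := by rintro rfl; exact hyF hxF
        have hxl : x ∉ l.map Prod.fst := fun hm => by
          obtain ⟨p, hp, e⟩ := List.mem_map.1 hm
          exact (hlR p hp).1 (e ▸ Finset.mem_insert_self _ _)
        have hyl : y ∉ l.map Prod.snd := fun hm => by
          obtain ⟨p, hp, rfl⟩ := List.mem_map.1 hm
          have := hc p.1 (hl.2.2 p hp).1 x hxF ((hlR p hp).2.trans hy.1)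
          exact (hlR p hp).1 (this ▸ Finset.mem_insert_self _ _)
        have := IH hRF' ((x, y) :: l)
          ⟨List.nodup_cons.2 ⟨hxl, hl.1⟩, List.nodup_cons.2 ⟨hyl, hl.2.1⟩, by
            intro p hp
            rcases List.mem_cons.1 hp with rfl | hp
            · exact ⟨hxF, hyF⟩
            · exact hl.2.2 p hp⟩ (by
            intro p hp
            rcases List.mem_cons.1 hp with rfl | hp
            · exact ⟨hxR, hy.1.symm⟩
            · exact hlR' p hp)
        rw [show pairPerm ((x, y) :: l) = pairPerm l * Equiv.swap x y from rfl, ← rho_mul] at this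
        rw [Equiv.Perm.sign_swap hne]
        simpa [pow_succ] using this
  have pos : ∀ R : Finset α, R ⊆ F → 0 < B (stabSum ρ Equiv.Perm.sign c (F \ R) v) v := by
    intro R
    induction R using Finset.induction_on with
    | empty =>
      intro _
      rw [Finset.sdiff_empty, hbase, map_smul, LinearMap.smul_apply, smul_eq_mul]
      exact mul_pos (card_colorStab_pos _ _) (hB.pos v hv0)
    | insert x R hxR IH =>
      intro hRF
      obtain ⟨hxF, hRF'⟩ := Finset.insert_subset_iff.1 hRF
      rw [stabSum_peel (x := x) (by simp), hS hxF hxR, map_sum, LinearMap.sum_apply]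
      refine Finset.sum_pos' (fun y hy => ?_) ⟨x, by simp, by simpa [rho_refl] using IH hRF'⟩
      simp only [Finset.mem_filter, Finset.mem_univ, true_and] at hy
      by_cases hyF : y ∈ F
      · obtain rfl := hc y hyF x hxF hy.1
        simpa [rho_refl] using (IH hRF').le
      · have hne : x ≠ y := by rintro rfl; exact hyF hxF
        have := nonneg R hRF' [(x, y)] ⟨by simp, by simp, by simpa using ⟨hxF, hyF⟩⟩
          (by simpa using ⟨hxR, hy.1.symm⟩)
        rw [Equiv.Perm.sign_swap hne]
        simpa [pairPerm] using this
  simpa using pos F subset_rfl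

end Positivity

/-! ### Tableaux and the removal of the first row -/

section Tableaux

variable {α : Type} [Fintype α] [DecidableEq α]

/-- `T`, giving the box of each label, is a bijection from the labels to the boxes of the Young
diagram with row lengths `lam`. -/
def IsTableau (lam : List ℕ) (T : α → ℕ × ℕ) : Prop :=
  ∃ e : α ≃ Fin lam.sum, ∀ x, T x = box lam (e x)

lemma isPartition_cons {a : ℕ} {lam : List ℕ} :
    IsPartition (a :: lam) ↔ 0 < a ∧ lam.headD 0 ≤ a ∧ IsPartition lam := by
  simp only [IsPartition, List.sortedGE_iff_pairwise, List.pairwise_cons, List.mem_cons,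
    forall_eq_or_imp]
  constructor
  · rintro ⟨⟨h1, h2⟩, h3, h4⟩
    refine ⟨h3, ?_, h2, h4⟩
    cases lam with
    | nil => simp
    | cons b l => simpa using h1 b
  · rintro ⟨h3, h, h2, h4⟩
    refine ⟨⟨fun b hb => ?_, h2⟩, h3, h4⟩
    cases lam with
    | nil => simp at hb
    | cons c l =>
      have : c ≤ a := by simpa using h
      rcases List.mem_cons.1 hb with rfl | hb
      · exact this
      · exact ((List.pairwise_cons.1 h2).1 b hb).trans this

lemma box_cons_of_lt {a j : ℕ} (lam : List ℕ) (h : j < a) : box (a :: lam) j = (0, j) := by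
  simp [box, h]

lemma box_cons_add (a j : ℕ) (lam : List ℕ) :
    box (a :: lam) (a + j) = ((box lam j).1 + 1, (box lam j).2) := by
  simp [box]

lemma box_col_lt : ∀ {lam : List ℕ}, IsPartition lam → ∀ {j : ℕ}, j < lam.sum →
    (box lam j).2 < lam.headD 0
  | [], _, j, hj => by simp at hj
  | a :: lam, h, j, hj => by
    rw [isPartition_cons] at h
    rcases lt_or_ge j a with hja | hja
    · simpa [box_cons_of_lt lam hja] using hja
    · obtain ⟨k, rfl⟩ := Nat.exists_eq_add_of_le hja
      rw [box_cons_add]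
      have hk : k < lam.sum := by simpa using hj
      exact (box_col_lt h.2.2 hk).trans_le h.2.1

omit [DecidableEq α] in
lemma IsTableau.card_eq {lam : List ℕ} {T : α → ℕ × ℕ} (hT : IsTableau lam T) :
    Fintype.card α = lam.sum := by
  obtain ⟨e, -⟩ := hT
  rw [Fintype.card_congr e, Fintype.card_fin]

omit [Fintype α] [DecidableEq α] in
lemma IsTableau.col_lt {a : ℕ} {lam : List ℕ} (hlam : IsPartition lam) {T : α → ℕ × ℕ}
    (hT : IsTableau (a :: lam) T) {x : α} (hx : (T x).1 ≠ 0) : (T x).2 < lam.headD 0 := by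
  obtain ⟨e, he⟩ := hT
  rw [he] at hx ⊢
  have hj := (e x).2
  generalize (e x : ℕ) = j at hx hj
  rcases lt_or_ge j a with hja | hja
  · simp [box_cons_of_lt lam hja] at hx
  · obtain ⟨k, rfl⟩ := Nat.exists_eq_add_of_le hja
    rw [box_cons_add]
    exact box_col_lt hlam (by simpa using hj)

lemma card_filter_box_zero (lam : List ℕ) :
    ((Finset.range lam.sum).filter fun j => (box lam j).1 = 0).card = lam.headD 0 := by
  cases lam with
  | nil => simp
  | cons a lam =>
    have : ((Finset.range (a :: lam).sum).filter fun j => (box (a :: lam) j).1 = 0) =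
        Finset.range a := by
      ext j
      simp only [Finset.mem_filter, Finset.mem_range, List.sum_cons]
      rcases lt_or_ge j a with hja | hja
      · simp [box_cons_of_lt lam hja, hja]; omega
      · obtain ⟨k, rfl⟩ := Nat.exists_eq_add_of_le hja
        simp [box_cons_add]
    rw [this, Finset.card_range, List.headD_cons]

lemma card_filter_box_one (a : ℕ) (lam : List ℕ) :
    ((Finset.range (a :: lam).sum).filter fun j => (box (a :: lam) j).1 = 1).card =
      lam.headD 0 := by
  rw [← card_filter_box_zero lam]
  symm
  refine Finset.card_bij (fun j _ => a + j) ?_ ?_ ?_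
  · intro j hj
    simpa [box_cons_add] using hj
  · intro j _ k _ h
    exact Nat.add_left_cancel h
  · intro j hj
    simp only [Finset.mem_filter, Finset.mem_range] at hj
    rcases lt_or_ge j a with hja | hja
    · simp [box_cons_of_lt lam hja] at hj
    · obtain ⟨k, rfl⟩ := Nat.exists_eq_add_of_le hja
      exact ⟨k, by simpa [box_cons_add] using hj, rfl⟩

omit [DecidableEq α] in
lemma IsTableau.card_row {lam : List ℕ} {T : α → ℕ × ℕ} (hT : IsTableau lam T) (i : ℕ) :
    (Finset.univ.filter fun x => (T x).1 = i).card =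
      ((Finset.range lam.sum).filter fun j => (box lam j).1 = i).card := by
  obtain ⟨e, he⟩ := hT
  refine Finset.card_bij (fun x _ => (e x : ℕ)) ?_ ?_ ?_
  · intro x hx
    simp only [Finset.mem_filter, Finset.mem_univ, true_and, Finset.mem_range] at hx ⊢
    exact ⟨(e x).2, by rw [← he]; exact hx⟩
  · intro x _ y _ h
    exact e.injective (Fin.ext h)
  · intro j hj
    simp only [Finset.mem_filter, Finset.mem_univ, true_and, Finset.mem_range] at hj ⊢
    have hej : (e (e.symm ⟨j, hj.1⟩) : ℕ) = j := by rw [Equiv.apply_symm_apply]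
    exact ⟨e.symm ⟨j, hj.1⟩, by rw [he, hej]; exact hj.2, hej⟩

omit [DecidableEq α] in
lemma IsTableau.card_first_row {lam : List ℕ} {T : α → ℕ × ℕ} (hT : IsTableau lam T) :
    (Finset.univ.filter fun x => (T x).1 = 0).card = lam.headD 0 := by
  rw [hT.card_row, card_filter_box_zero]

omit [DecidableEq α] in
lemma IsTableau.card_second_row {a : ℕ} {lam : List ℕ} {T : α → ℕ × ℕ}
    (hT : IsTableau (a :: lam) T) :
    (Finset.univ.filter fun x => (T x).1 = 1).card = lam.headD 0 := by
  rw [hT.card_row, card_filter_box_one]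

variable {V : Type*} [AddCommGroup V] [Module ℚ V]

/-- The row symmetrizer of a tableau, acting on a representation. -/
abbrev rowSum (ρ : Representation ℚ (Equiv.Perm α) V) (T : α → ℕ × ℕ) (S : Finset α) :
    V →ₗ[ℚ] V := stabSum ρ 1 (fun x => (T x).1) S

/-- The column antisymmetrizer of a tableau, acting on a representation. -/
abbrev colSum (ρ : Representation ℚ (Equiv.Perm α) V) (T : α → ℕ × ℕ) (S : Finset α) :
    V →ₗ[ℚ] V := stabSum ρ Equiv.Perm.sign (fun x => (T x).2) S

variable {β : Type} [Fintype β] [DecidableEq β]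

/-- Permutations of `β`, extended by the identity, are the permutations of `α` which fix the
complement of `β` pointwise. -/
lemma sum_colorStab_embedding {M ι ι' : Type*} [DecidableEq ι] [DecidableEq ι'] [AddCommMonoid M]
    (i : β ↪ α) {c : α → ι} {c' : β → ι'}
    (hc : ∀ x y, c (i x) = c (i y) ↔ c' x = c' y) {S : Finset α}
    (hS : ∀ x, x ∈ S ↔ x ∉ Set.range i) (f : Equiv.Perm α → M) :
    ∑ g ∈ colorStab c S, f g = ∑ h ∈ colorStab c' ∅, f (Equiv.Perm.viaEmbeddingHom i h) := by
  symm
  refine Finset.sum_bij (fun h _ => Equiv.Perm.viaEmbeddingHom i h) ?_ ?_ ?_ (fun _ _ => rfl)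
  · intro h hh
    rw [mem_colorStab] at hh ⊢
    rw [Equiv.Perm.viaEmbeddingHom_apply]
    refine ⟨fun j => ?_, fun s hs => Equiv.Perm.viaEmbedding_apply_of_notMem _ _ _ ((hS s).1 hs)⟩
    by_cases hj : j ∈ Set.range i
    · obtain ⟨x, rfl⟩ := hj
      rw [Equiv.Perm.viaEmbedding_apply, hc]
      exact hh.1 x
    · rw [Equiv.Perm.viaEmbedding_apply_of_notMem _ _ _ hj]
  · intro h _ h' _ e
    exact Equiv.Perm.viaEmbeddingHom_injective i e
  · intro g hg
    rw [mem_colorStab] at hg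
    have h1 : ∀ x, ∃ y, i y = g (i x) := by
      intro x
      by_contra hx
      have := hg.2 _ ((hS (g (i x))).2 hx)
      rw [g.injective this] at hx
      exact hx ⟨x, rfl⟩
    choose k hk using h1
    have hkinj : Function.Injective k := fun x y hxy =>
      i.injective (g.injective (by rw [← hk, ← hk, hxy]))
    let h : Equiv.Perm β := Equiv.ofBijective k (Finite.injective_iff_bijective.1 hkinj)
    refine ⟨h, ?_, ?_⟩
    · rw [mem_colorStab]
      refine ⟨fun j => ?_, by simp⟩
      rw [← hc, show i (h j) = g (i j) from hk j]
      exact hg.1 _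
    · rw [Equiv.Perm.viaEmbeddingHom_apply]
      ext x
      by_cases hx : x ∈ Set.range i
      · obtain ⟨y, rfl⟩ := hx
        rw [Equiv.Perm.viaEmbedding_apply]
        exact hk y
      · rw [Equiv.Perm.viaEmbedding_apply_of_notMem _ _ _ hx, hg.2 x ((hS x).2 hx)]

lemma sign_viaEmbeddingHom (i : β ↪ α) (h : Equiv.Perm β) :
    Equiv.Perm.sign (Equiv.Perm.viaEmbeddingHom i h) = Equiv.Perm.sign h := by
  classical
  rw [Equiv.Perm.viaEmbeddingHom_apply, Equiv.Perm.viaEmbedding, Equiv.Perm.sign_extendDomain]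

/-- The restriction of a representation of the permutations of `α` to those of a subset `β`. -/
abbrev resEmb (i : β ↪ α) (ρ : Representation ℚ (Equiv.Perm α) V) :
    Representation ℚ (Equiv.Perm β) V :=
  MonoidHom.comp ρ (Equiv.Perm.viaEmbeddingHom i)

lemma stabSum_embedding {ι ι' : Type*} [DecidableEq ι] [DecidableEq ι']
    (ρ : Representation ℚ (Equiv.Perm α) V) {χ : Equiv.Perm α →* ℤˣ} {χ' : Equiv.Perm β →* ℤˣ}
    (i : β ↪ α) (hχ : ∀ h, χ (Equiv.Perm.viaEmbeddingHom i h) = χ' h) {c : α → ι} {c' : β → ι'}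
    (hc : ∀ x y, c (i x) = c (i y) ↔ c' x = c' y) {S : Finset α}
    (hS : ∀ x, x ∈ S ↔ x ∉ Set.range i) (v : V) :
    stabSum (resEmb i ρ) χ' c' ∅ v = stabSum ρ χ c S v := by
  rw [stabSum_apply, stabSum_apply, sum_colorStab_embedding i hc hS]
  refine Finset.sum_congr rfl fun h _ => ?_
  rw [hχ]
  rfl

variable {ρ : Representation ℚ (Equiv.Perm α) V} {B : V →ₗ[ℚ] V →ₗ[ℚ] ℚ} {F : Finset α} {v : V}

/-- If `F` is a full fibre of the colouring, symmetrizing a vector invariant under the permutations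
of `F` amounts to symmetrizing over the permutations which fix `F` pointwise. -/
lemma exists_stabSum_eq_smul {ι : Type*} [DecidableEq ι] {c : α → ι}
    (hv : ∀ i ∈ F, ∀ i' ∈ F, ρ (Equiv.swap i i') v = v)
    (hc : ∀ x ∈ F, ∀ y, c y = c x ↔ y ∈ F) :
    ∃ N : ℚ, 0 < N ∧ stabSum ρ 1 c ∅ v = N • stabSum ρ 1 c F v := by
  have : ∀ R : Finset α, R ⊆ F →
      ∃ N : ℚ, 0 < N ∧ stabSum ρ 1 c (F \ R) v = N • stabSum ρ 1 c F v := by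
    intro R
    induction R using Finset.induction_on with
    | empty => exact fun _ => ⟨1, one_pos, by simp⟩
    | insert x R hxR IH =>
      intro hRF
      obtain ⟨hxF, hRF'⟩ := Finset.insert_subset_iff.1 hRF
      obtain ⟨N, hN, e⟩ := IH hRF'
      have hS : insert x (F \ insert x R) = F \ R := by
        ext z
        by_cases h : z = x
        · subst h; simp [hxF, hxR]
        · simp [h]
      refine ⟨(Finset.univ.filter fun y => c y = c x ∧ y ∉ F \ insert x R).card * N, ?_, ?_⟩
      · refine mul_pos ?_ hN
        exact_mod_cast Finset.card_pos.2 ⟨x, by simp⟩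
      · rw [stabSum_peel_right (x := x) (by simp), hS, Finset.sum_congr rfl
          (g := fun _ => N • stabSum ρ 1 c F v), Finset.sum_const, mul_smul, Nat.cast_smul_eq_nsmul]
        intro y hy
        simp only [Finset.mem_filter, Finset.mem_univ, true_and] at hy
        rw [hv x hxF y ((hc x hxF y).1 hy.1), ← e]
        simp
  simpa using this F subset_rfl

/-- Adding `F` as a new first row to a tableau on the complement of `F`: if the dual Young
symmetrizer of the smaller tableau (first the row sum, then the column sum) does not kill the
highest vector `v`, then that of the larger tableau does not kill it either. -/
lemma exists_tableau_cons (hB : IsInvariantInner ρ B) (hv : v ∈ highest ρ F) {lam : List ℕ}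
    {T' : {x // x ∉ F} → ℕ × ℕ} (hT' : IsTableau lam T')
    (h : colSum (resEmb (Function.Embedding.subtype _) ρ) T' ∅
      (rowSum (resEmb (Function.Embedding.subtype _) ρ) T' ∅ v) ≠ 0) :
    ∃ T : α → ℕ × ℕ, IsTableau (F.card :: lam) T ∧ (∀ x, (T x).1 = 0 ↔ x ∈ F) ∧
      colSum ρ T ∅ (rowSum ρ T ∅ v) ≠ 0 := by
  obtain ⟨e', he'⟩ := hT'
  let f : {x // x ∈ F} ≃ Fin F.card := F.equivFin
  let e : α ≃ Fin (F.card + lam.sum) :=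
    ((Equiv.sumCompl (· ∈ F)).symm.trans (Equiv.sumCongr f e')).trans finSumFinEquiv
  let T : α → ℕ × ℕ := fun x => box (F.card :: lam) (e x)
  have hTF : ∀ x (hx : x ∈ F), T x = (0, (f ⟨x, hx⟩ : ℕ)) := by
    intro x hx
    have : (e x : ℕ) = f ⟨x, hx⟩ := by
      simp [e, Equiv.trans_apply, Equiv.sumCompl_symm_apply_of_pos (p := (· ∈ F)) hx]
    simp only [T, this]
    exact box_cons_of_lt lam (f ⟨x, hx⟩).2
  have hTF' : ∀ x (hx : x ∉ F), T x = ((T' ⟨x, hx⟩).1 + 1, (T' ⟨x, hx⟩).2) := by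
    intro x hx
    have : (e x : ℕ) = F.card + e' ⟨x, hx⟩ := by
      simp [e, Equiv.trans_apply, Equiv.sumCompl_symm_apply_of_neg (p := (· ∈ F)) hx]
    simp only [T, this, he']
    exact box_cons_add _ _ _
  have hrow : ∀ x, (T x).1 = 0 ↔ x ∈ F := by
    intro x
    by_cases hx : x ∈ F
    · simp [hTF x hx, hx]
    · simp [hTF' x hx, hx]
  refine ⟨T, ⟨e, fun _ => rfl⟩, hrow, ?_⟩
  have hS : ∀ x, x ∈ F ↔ x ∉ Set.range (Function.Embedding.subtype (· ∉ F)) := by simp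
  have er : ∀ w, rowSum (resEmb (Function.Embedding.subtype _) ρ) T' ∅ w = rowSum ρ T F w := by
    intro w
    refine stabSum_embedding ρ _ (fun _ => rfl) ?_ hS w
    rintro ⟨x, hx⟩ ⟨y, hy⟩
    simp [hTF' x hx, hTF' y hy]
  have ec : ∀ w, colSum (resEmb (Function.Embedding.subtype _) ρ) T' ∅ w = colSum ρ T F w := by
    intro w
    refine stabSum_embedding ρ _ (sign_viaEmbeddingHom _) ?_ hS w
    rintro ⟨x, hx⟩ ⟨y, hy⟩
    simp [hTF' x hx, hTF' y hy]
  rw [er, ec] at h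
  have hcol : ∀ x ∈ F, ∀ y ∈ F, (T x).2 = (T y).2 → x = y := by
    intro x hx y hy hxy
    rw [hTF x hx, hTF y hy] at hxy
    simpa using f.injective (Fin.ext hxy)
  -- the column sum over all of `α` absorbs the column sum over the complement of `F`, so it
  -- suffices that it does not kill `colSum ρ T F (rowSum ρ T F v)`
  have hpos := form_colSum_pos (c := fun x => (T x).2) hB
    (stabSum_mem_highest (χ := Equiv.Perm.sign) (stabSum_mem_highest hv)) h hcol
    (fun g hg => rho_stabSum hg _)
  obtain ⟨N, hN, eN⟩ := exists_stabSum_eq_smul (c := fun x => (T x).1) hv.1 (by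
    intro x hx y
    simp only [(hrow x).2 hx, hrow])
  rw [rowSum, eN, map_smul]
  refine smul_ne_zero hN.ne' fun h0 => ?_
  rw [stabSum_stabSum (colorStab_mono (Finset.empty_subset F)), h0] at hpos
  simp at hpos

lemma setStab_subset {ι : Type*} [DecidableEq ι] {c : α → ι} {X : Finset α}
    (hX : ∀ x ∈ X, ∀ y ∈ X, c x = c y) :
    colorStab (fun _ => ()) Xᶜ ⊆ colorStab c ∅ := by
  intro g hg
  rw [mem_setStab] at hg
  rw [mem_colorStab]
  refine ⟨fun j => ?_, by simp⟩
  by_cases hj : j ∈ X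
  · refine hX _ ?_ _ hj
    by_contra hgj
    have := hg _ hgj
    rw [g.injective this] at hgj
    exact hgj hj
  · rw [hg j hj]

lemma setSym_ne_zero_of_stabSum {ι : Type*} [DecidableEq ι] {c : α → ι} {X : Finset α}
    (hX : ∀ x ∈ X, ∀ y ∈ X, c x = c y) (h : stabSum ρ 1 c ∅ v ≠ 0) : setSym ρ X v ≠ 0 := by
  intro h0
  have := stabSum_stabSum (ρ := ρ) (χ := 1) (setStab_subset hX) v
  rw [show stabSum ρ 1 (fun _ => ()) Xᶜ v = 0 from h0, map_zero] at this
  exact (smul_ne_zero (card_colorStab_pos _ _).ne' h) this.symm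

lemma setSym_comm {X Y : Finset α} (h : Disjoint X Y) (v : V) :
    setSym ρ X (setSym ρ Y v) = setSym ρ Y (setSym ρ X v) := by
  simp only [stabSum_apply, map_sum, MonoidHom.one_apply, Units.val_one, Int.cast_one, one_smul]
  rw [Finset.sum_comm]
  refine Finset.sum_congr rfl fun g hg => Finset.sum_congr rfl fun k hk => ?_
  rw [mem_setStab] at hg hk
  have : Equiv.Perm.Disjoint g k := fun x => by
    by_cases hx : x ∈ X
    · exact Or.inr (hk x (Finset.disjoint_left.1 h hx))
    · exact Or.inl (hg x hx)
  rw [rho_mul, rho_mul, this.commute.eq]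

lemma setSym_singleton (x : α) (v : V) : setSym ρ {x} v = v := by
  have := setSym_insert (ρ := ρ) (Finset.notMem_empty x) v
  rw [setSym_empty] at this
  simpa using this

lemma swap_setSym {X : Finset α} {i i' : α} (hi : i ∈ X) (hi' : i' ∈ X) (v : V) :
    ρ (Equiv.swap i i') (setSym ρ X v) = setSym ρ X v := by
  have := rho_stabSum (ρ := ρ) (χ := 1) (c := fun _ : α => ()) (S := Xᶜ)
    (swap_mem_colorStab (x := i) (y := i') rfl (by simpa using hi) (by simpa using hi')) v
  simpa using this

end Tableaux

/-- A nonzero vector of a representation of a symmetric group is not killed by all dual Young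
symmetrizers. The first row of a suitable tableau is a largest set `F` of labels whose
symmetrization does not kill the vector: then symmetrizing over `F` gives a highest vector, and
induction applies to the remaining labels. -/
theorem exists_tableau_ne_zero {V : Type*} [AddCommGroup V] [Module ℚ V]
    {B : V →ₗ[ℚ] V →ₗ[ℚ] ℚ} (n : ℕ) : ∀ (α : Type) [Fintype α] [DecidableEq α],
    Fintype.card α = n → ∀ ρ : Representation ℚ (Equiv.Perm α) V, IsInvariantInner ρ B →
    ∀ v : V, v ≠ 0 → ∃ (lam : List ℕ) (T : α → ℕ × ℕ), IsPartition lam ∧ IsTableau lam T ∧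
      colSum ρ T ∅ (rowSum ρ T ∅ v) ≠ 0 := by
  classical
  induction n using Nat.strong_induction_on with
  | _ n IH =>
  intro α _ _ hcard ρ hB v hv
  rcases isEmpty_or_nonempty α with hα | ⟨⟨x⟩⟩
  · refine ⟨[], fun _ => (0, 0), 
      ⟨List.sortedGE_iff_pairwise.2 List.Pairwise.nil, by simp⟩,
      ⟨Equiv.equivOfIsEmpty _ (Fin 0),
      fun x => hα.elim x⟩, ?_⟩
    rw [stabSum_eq_smul, stabSum_eq_smul]
    · exact smul_ne_zero (card_colorStab_pos _ _).ne' (smul_ne_zero (card_colorStab_pos _ _).ne' hv)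
    all_goals
      intro g _
      rw [Subsingleton.elim g 1]
      simp
  · obtain ⟨F, hF, hmax⟩ := Finset.exists_max_image
      (Finset.univ.filter fun X : Finset α => setSym ρ X v ≠ 0) Finset.card
      ⟨{x}, by
        rw [Finset.mem_filter, setSym_singleton]; exact ⟨Finset.mem_univ _, hv⟩⟩
    replace hF := (Finset.mem_filter.1 hF).2
    replace hmax : ∀ X, setSym ρ X v ≠ 0 → X.card ≤ F.card := fun X hX =>
      hmax X (Finset.mem_filter.2 ⟨Finset.mem_univ _, hX⟩)
    have hFpos : 0 < F.card := by
      have := hmax {x} (by rwa [setSym_singleton])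
      simpa using this
    set w := setSym ρ F v with hw
    have hwF : w ∈ highest ρ F := by
      refine ⟨fun i hi i' hi' => swap_setSym hi hi' v, fun j hj => ?_⟩
      rw [hw, ← setSym_insert hj]
      by_contra hne
      have := hmax _ hne
      rw [Finset.card_insert_of_notMem hj] at this
      omega
    have hβ : Fintype.card {x // x ∉ F} < n := by
      rw [Fintype.card_subtype_compl, Fintype.card_coe, hcard]
      have := Finset.card_le_univ F
      omega
    obtain ⟨lam, T', hlam, hT', hne⟩ := IH _ hβ {x // x ∉ F} rfl
      (resEmb (Function.Embedding.subtype _) ρ) ⟨fun g => hB.inv _, hB.pos⟩ w hF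
    obtain ⟨T, hT, hrow, hTne⟩ := exists_tableau_cons hB hwF hT' hne
    -- the rows decrease: the second row also has nonzero symmetrization, and `F` is largest
    refine ⟨F.card :: lam, T, isPartition_cons.2 ⟨hFpos, ?_, hlam⟩, hT, ?_⟩
    · rw [← hT.card_second_row]
      refine hmax _ fun h0 => ?_
      have hdisj : Disjoint (Finset.univ.filter fun x => (T x).1 = 1) F := by
        rw [Finset.disjoint_left]
        intro x hx hxF
        have := (hrow x).2 hxF
        simp [this] at hx
      refine setSym_ne_zero_of_stabSum (c := fun x => (T x).1)
        (X := Finset.univ.filter fun x => (T x).1 = 1) ?_ (fun h => hTne (by rw [h, map_zero]) :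
          rowSum ρ T ∅ w ≠ 0) ?_
      · intro x hx y hy
        simp only [Finset.mem_filter, Finset.mem_univ, true_and] at hx hy
        rw [hx, hy]
      · rw [hw, setSym_comm hdisj, h0, map_zero]
    · intro h0
      apply hTne
      rw [rowSum, hw, stabSum_stabSum (setStab_subset fun x hx y hy => by
        rw [(hrow x).2 hx, (hrow y).2 hy]), map_smul, h0, smul_zero]

/-! ### Young symmetrizers on vectors without the larger shapes -/

section Injectivity

variable {α : Type} [Fintype α] [DecidableEq α] {V : Type*} [AddCommGroup V] [Module ℚ V]
  {ρ : Representation ℚ (Equiv.Perm α) V} {B : V →ₗ[ℚ] V →ₗ[ℚ] ℚ}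

omit [Fintype α] [DecidableEq α] in
/-- In a tableau whose first row is strictly longer than the others, the last box of the first row
is alone in its column. -/
lemma IsTableau.col_lt_of_ne {a : ℕ} {lam : List ℕ} (hlam : IsPartition lam)
    (hla : lam.headD 0 ≤ a) {T : α → ℕ × ℕ} (hT : IsTableau ((a + 1) :: lam) T) {z : α}
    (hz : T z = (0, a)) {x : α} (hx : x ≠ z) : (T x).2 < a := by
  by_cases hr : (T x).1 = 0
  · obtain ⟨e, he⟩ := hT
    have key : ∀ x, (T x).1 = 0 → (T x).2 = e x ∧ (e x : ℕ) < a + 1 := by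
      intro x hx
      rw [he] at hx ⊢
      rcases lt_or_ge (e x : ℕ) (a + 1) with h | h
      · exact ⟨by rw [box_cons_of_lt lam h], h⟩
      · obtain ⟨k, hk⟩ := Nat.exists_eq_add_of_le h
        rw [hk, box_cons_add] at hx
        simp at hx
    obtain ⟨h1, h2⟩ := key x hr
    obtain ⟨h3, -⟩ := key z (by rw [hz])
    rw [hz] at h3
    have : (e x : ℕ) ≠ e z := fun h => hx (e.injective (Fin.ext h))
    dsimp only at h3
    omega
  · exact (hT.col_lt hlam hr).trans_le hla

/-- Let `y` be a Young symmetrizer applied to a vector. Symmetrizing `y` over a set of labels that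
is too large to meet each column at most once gives zero. -/
lemma setSym_eq_zero_of_card {T : α → ℕ × ℕ} {S X : Finset α} {m : ℕ} (hX : m < X.card)
    (hcol : ∀ h ∈ colorStab (fun x => (T x).1) S, ∀ x ∈ X, (T (h⁻¹ x)).2 < m) (w : V) :
    setSym ρ X (rowSum ρ T S (colSum ρ T ∅ w)) = 0 := by
  rw [stabSum_apply (c := fun x => (T x).1), map_sum]
  refine Finset.sum_eq_zero fun h hh => ?_
  obtain ⟨x, hx, x', hx', hne, e⟩ := Finset.exists_ne_map_eq_of_card_lt_of_maps_to
    (t := Finset.range m) (by simpa using hX) (f := fun x => (T (h⁻¹ x)).2)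
    (fun x hx => by simpa using hcol h hh x hx)
  have hh1 : ∀ x, h (h⁻¹ x) = x := fun x => h.apply_symm_apply x
  rw [map_smul, stabSum_rho_stabSum_eq_zero (x := h⁻¹ x) (x' := h⁻¹ x')
    (fun e => hne (h⁻¹.injective e)) rfl (by simpa [hh1] using hx) (by simpa [hh1] using hx')
    e (by simp) (by simp), smul_zero]

/-- A dual Young symmetrizer kills a vector which is invariant under the permutations of a set `X`
of labels outside the first row, if `X` has more elements than the second row has boxes. -/
lemma colSum_rowSum_eq_zero_of_card {a : ℕ} {lam : List ℕ} (hlam : IsPartition lam)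
    {T : α → ℕ × ℕ} (hT : IsTableau (a :: lam) T) {X : Finset α} (hX : lam.headD 0 < X.card)
    (hrow : ∀ x ∈ X, (T x).1 ≠ 0) {y : V}
    (hy : ∀ x ∈ X, ∀ x' ∈ X, ρ (Equiv.swap x x') y = y) :
    colSum ρ T ∅ (rowSum ρ T ∅ y) = 0 := by
  rw [stabSum_apply (c := fun x => (T x).1), map_sum]
  refine Finset.sum_eq_zero fun g hg => ?_
  rw [mem_colorStab] at hg
  obtain ⟨x, hx, x', hx', hne, e⟩ := Finset.exists_ne_map_eq_of_card_lt_of_maps_to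
    (t := Finset.range (lam.headD 0)) (by simpa using hX) (f := fun x => (T (g x)).2)
    (fun x hx => by
      simpa using hT.col_lt hlam (x := g x) (by rw [hg.1 x]; exact hrow x hx))
  have h1 := stabSum_rho (ρ := ρ) (χ := Equiv.Perm.sign) (c := fun x => (T x).2)
    (swap_mem_colorStab (S := ∅) (x := g x) (y := g x') e (by simp) (by simp)) (ρ g y)
  rw [rho_mul, ← Equiv.mul_swap_eq_swap_mul, ← rho_mul, hy x hx x' hx',
    Equiv.Perm.sign_swap (g.injective.ne hne)] at h1
  have h2 : colSum ρ T ∅ (ρ g y) = 0 := eq_zero_of_eq_neg (h1.trans (by simp))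
  rw [map_smul, h2, smul_zero]

/-- Let `T` be a tableau of shape `(a + 1, lam)` and `z` the last label of its first row. Suppose
that no Young symmetrizer of a shape `(a, κ)` with `κ` as below acts nontrivially. If a vector in
the image of the Young symmetrizer of `T` without `z` is killed by the symmetrization over the
whole first row of `T`, then it vanishes.

The vector `y` in question is a highest vector for the first row without `z`. If it were nonzero,
some tableau on the remaining labels, of shape `κ`, would not kill it; then neither would the
tableau of shape `(a, κ)`, a contradiction. -/
theorem rowSum_colSum_eq_zero (hB : IsInvariantInner ρ B) {lam : List ℕ} (hlam : IsPartition lam)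
    {a : ℕ} (hla : lam.headD 0 ≤ a) {T : α → ℕ × ℕ} (hT : IsTableau ((a + 1) :: lam) T) {z : α}
    (hz : T z = (0, a))
    (hvan : ∀ κ : List ℕ, IsPartition κ → κ.sum = lam.sum + 1 → lam.headD 0 ≤ κ.headD 0 →
      κ.headD 0 ≤ a → ∀ T' : α → ℕ × ℕ, IsTableau (a :: κ) T' →
      ∀ u : V, rowSum ρ T' ∅ (colSum ρ T' ∅ u) = 0)
    {w : V} (hw : rowSum ρ T ∅ (colSum ρ T ∅ w) = 0) : rowSum ρ T {z} (colSum ρ T ∅ w) = 0 := by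
  set y := rowSum ρ T {z} (colSum ρ T ∅ w) with hy
  set F : Finset α := (Finset.univ.filter fun x => (T x).1 = 0).erase z with hF
  have hzF : z ∉ F := Finset.notMem_erase _ _
  have memF : ∀ x, x ∈ F ↔ x ≠ z ∧ (T x).1 = 0 := fun x => by simp [hF]
  have cardF : F.card = a := by
    rw [hF, Finset.card_erase_of_mem (by simp [hz]), hT.card_first_row]
    simp
  have colT : ∀ x, (T x).2 < a + 1 := by
    intro x
    rcases eq_or_ne x z with rfl | hx
    · simp [hz]
    · exact (hT.col_lt_of_ne hlam hla hz hx).trans (Nat.lt_succ_self a)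
  have hinv : ∀ x x' : α, (T x).1 = (T x').1 → x ≠ z → x' ≠ z → ρ (Equiv.swap x x') y = y := by
    intro x x' h hx hx'
    have := rho_stabSum (ρ := ρ) (χ := 1) (c := fun x => (T x).1)
      (swap_mem_colorStab (S := {z}) h (by simpa using hx) (by simpa using hx')) (colSum ρ T ∅ w)
    simpa using this
  have hsymF : setSym ρ F y = ((colorStab (fun _ : α => ()) Fᶜ).card : ℚ) • y := by
    refine stabSum_eq_smul fun g hg => ?_
    have hsub := setStab_subset (c := fun x => (T x).1) (X := F) (fun x hx x' hx' => by
      rw [((memF x).1 hx).2, ((memF x').1 hx').2]) hg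
    have hg' : g ∈ colorStab (fun x => (T x).1) {z} := by
      rw [mem_colorStab] at hsub ⊢
      exact ⟨hsub.1, by simpa using mem_setStab.1 hg z hzF⟩
    exact rho_stabSum hg' _
  have hhigh : y ∈ highest ρ F := by
    refine mem_highest.2 ⟨fun i hi i' hi' => ?_, fun j hj => ?_⟩
    · rw [memF] at hi hi'
      exact hinv i i' (hi.2.trans hi'.2.symm) hi.1 hi'.1
    · rcases eq_or_ne j z with rfl | hjz
      · have hfil : (Finset.univ.filter fun x => (T x).1 = (T j).1 ∧ x ∉ (∅ : Finset α)) =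
            insert j F := by
          ext x
          rcases eq_or_ne x j with rfl | hx
          · simp
          · simp [memF, hx, hz]
        rw [rowSum, stabSum_peel (x := j) (by simp), hfil, Finset.sum_insert hzF] at hw
        simpa [rho_refl] using hw
      · have h0 : setSym ρ (insert j F) y = 0 := by
          refine setSym_eq_zero_of_card (m := a) ?_ ?_ w
          · rw [Finset.card_insert_of_notMem hj, cardF]; exact Nat.lt_succ_self a
          -- `h` fixes `z`, so the labels `h⁻¹ x` avoid the column of `z`
          · intro h hh x hx
            refine hT.col_lt_of_ne hlam hla hz fun e => ?_
            have h1 := (mem_colorStab.1 hh).2 z (by simp)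
            have h2 : x = z := by rw [← h1, ← e]; exact (h.apply_symm_apply x).symm
            rcases Finset.mem_insert.1 hx with h3 | h3
            · exact hjz (h3 ▸ h2)
            · exact hzF (h2 ▸ h3)
        rw [setSym_insert hj, hsymF] at h0
        simp only [map_smul] at h0
        rw [← Finset.smul_sum, ← smul_add] at h0
        exact (smul_eq_zero.1 h0).resolve_left (card_colorStab_pos _ _).ne'
  by_contra hne
  obtain ⟨κ, T₀, hκ, hT₀, h₀⟩ := exists_tableau_ne_zero _ {x // x ∉ F} rfl
    (resEmb (Function.Embedding.subtype _) ρ) ⟨fun g => hB.inv _, hB.pos⟩ y hne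
  obtain ⟨T', hT', hrow', h'⟩ := exists_tableau_cons hB hhigh hT₀ h₀
  rw [cardF] at hT'
  have hsum : κ.sum = lam.sum + 1 := by
    have h1 := hT.card_eq
    have h2 := hT'.card_eq
    simp only [List.sum_cons] at h1 h2
    omega
  have hle : κ.headD 0 ≤ a := by
    by_contra! hlt
    rw [← hT'.card_second_row] at hlt
    -- symmetrize over `a + 1` labels of the first row of `κ`
    obtain ⟨X, hXsub, hXcard⟩ := Finset.exists_subset_card_eq (Nat.succ_le_of_lt hlt)
    have hXrow : ∀ x ∈ X, (T' x).1 = 1 := fun x hx => by simpa using hXsub hx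
    have hXF : ∀ x ∈ X, x ∉ F := fun x hx hxF => by
      have := (hrow' x).2 hxF
      rw [hXrow x hx] at this
      exact one_ne_zero this
    have hv : setSym ρ X y ≠ 0 := by
      refine setSym_ne_zero_of_stabSum (c := fun x => (T' x).1) ?_ (fun h => h' ?_)
      · intro x hx x' hx'
        rw [hXrow x hx, hXrow x' hx']
      · rw [rowSum, h, map_zero]
    set v := setSym ρ X y with hvdef
    have hvh : v ∈ highest ρ F := by
      rw [hvdef, stabSum_apply]
      exact Submodule.sum_mem _ fun g hg => Submodule.smul_mem _ _ (rho_mem_highest hhigh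
        fun x hx => mem_setStab.1 hg x fun hxX => hXF x hxX hx)
    -- count the transpositions between `F` and `X` in two ways
    have e1 : ∑ x ∈ X, (v + ∑ i ∈ F, ρ (Equiv.swap x i) v) = 0 :=
      Finset.sum_eq_zero fun x hx => (mem_highest.1 hvh).2 x (hXF x hx)
    have e2 : ∑ i ∈ F, (v + ∑ x ∈ X, ρ (Equiv.swap i x) v) = 0 := by
      refine Finset.sum_eq_zero fun i hi => ?_
      have hiX : i ∉ X := fun h => hXF i h hi
      rw [hvdef, ← setSym_insert hiX]
      refine setSym_eq_zero_of_card (m := a + 1) ?_ (fun h _ x _ => colT _) w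
      rw [Finset.card_insert_of_notMem hiX, hXcard]
      exact Nat.lt_succ_self _
    rw [Finset.sum_add_distrib, Finset.sum_const, hXcard, Finset.sum_comm] at e1
    rw [Finset.sum_add_distrib, Finset.sum_const, cardF] at e2
    have e3 : ∑ i ∈ F, ∑ x ∈ X, ρ (Equiv.swap x i) v = ∑ i ∈ F, ∑ x ∈ X, ρ (Equiv.swap i x) v :=
      Finset.sum_congr rfl fun i _ => Finset.sum_congr rfl fun x _ => by rw [Equiv.swap_comm]
    rw [e3, Nat.succ_eq_add_one, succ_nsmul, add_right_comm, e2, zero_add] at e1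
    exact hv e1
  -- the second row of `T` meets each column of `κ` at most once
  have hge : lam.headD 0 ≤ κ.headD 0 := by
    by_contra! hlt
    refine h' (colSum_rowSum_eq_zero_of_card hκ hT'
      (X := Finset.univ.filter fun x => (T x).1 = 1) (by rwa [hT.card_second_row]) ?_ ?_)
    · intro x hx h0
      have := (memF x).1 ((hrow' x).1 h0)
      simp [this.2] at hx
    · have hxz : ∀ x ∈ Finset.univ.filter (fun x => (T x).1 = 1), (T x).1 = 1 ∧ x ≠ z := by
        intro x hx
        simp only [Finset.mem_filter, Finset.mem_univ, true_and] at hx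
        exact ⟨hx, by rintro rfl; simp [hz] at hx⟩
      intro x hx x' hx'
      exact hinv x x' ((hxz x hx).1.trans (hxz x' hx').1.symm) (hxz x hx).2 (hxz x' hx').2
  -- row and column sums are self-adjoint, so the dual Young symmetrizer is the adjoint of the
  -- Young symmetrizer
  have hzero := hvan κ hκ hsum hge hle T' hT' (colSum ρ T' ∅ (rowSum ρ T' ∅ y))
  have := hB.pos _ h'
  rw [hB.stabSum_left, hB.stabSum_left, hzero, map_zero] at this
  exact lt_irrefl _ this

end Injectivity

/-! ### Multiplicities as dimensions in the image of the Young symmetrizer -/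

section Multiplicity

variable {G : Type*} [Group G] [Fintype G]

/-- The rational group algebra of a finite group is von Neumann regular. -/
lemma exists_eq_mul_mul (e : MonoidAlgebra ℚ G) : ∃ r, e = e * r * e := by
  -- the left ideal generated by `e` is also generated by an idempotent `f = r * e`
  obtain ⟨f, hf, hef⟩ := IsSemisimpleRing.ideal_eq_span_idempotent (Ideal.span {e})
  obtain ⟨r, hr⟩ := Ideal.mem_span_singleton'.1 (hef ▸ Ideal.mem_span_singleton_self f :
    f ∈ Ideal.span {e})
  obtain ⟨s, hs⟩ := Ideal.mem_span_singleton'.1 (hef ▸ Ideal.mem_span_singleton_self e :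
    e ∈ Ideal.span {f})
  refine ⟨r, ?_⟩
  rw [mul_assoc, hr, ← hs, mul_assoc, hf.eq]

variable {V W : Type*} [AddCommGroup V] [Module ℚ V] [AddCommGroup W] [Module ℚ W]
  {ρ : Representation ℚ G V} {σ : Representation ℚ G W}

omit [Fintype G] in
lemma intertwiningMap_asAlgebraHom (f : ρ.IntertwiningMap σ) (x : MonoidAlgebra ℚ G) (v : V) :
    f (ρ.asAlgebraHom x v) = σ.asAlgebraHom x (f v) := by
  induction x using MonoidAlgebra.induction_on with
  | of g => simpa using congr($(f.isIntertwining' g) v)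
  | add x y hx hy =>
    rw [map_add, map_add, LinearMap.add_apply, LinearMap.add_apply, map_add, hx, hy]
  | smul r x hx =>
    rw [map_smul, map_smul, LinearMap.smul_apply, LinearMap.smul_apply, map_smul, hx]

/-- Homomorphisms from the left ideal generated by `e` into `W` correspond to vectors in `e W`. -/
lemma finrank_intertwiningMap_span (e : MonoidAlgebra ℚ G) (σ : Representation ℚ G W) :
    Module.finrank ℚ ((Representation.ofModule' (Ideal.span {e})).IntertwiningMap σ) =
      Module.finrank ℚ (LinearMap.range (σ.asAlgebraHom e)) := by
  set I : Ideal (MonoidAlgebra ℚ G) := Ideal.span {e} with hI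
  let τ : Representation ℚ G I := Representation.ofModule' I
  have hτ : ∀ (x : MonoidAlgebra ℚ G) (m : I), τ.asAlgebraHom x m = x • m := by
    intro x m
    simp [τ, Representation.asAlgebraHom, Representation.ofModule']
  have he : e ∈ I := Ideal.mem_span_singleton_self e
  let Φ : τ.IntertwiningMap σ →ₗ[ℚ] W :=
    { toFun := fun f => f ⟨e, he⟩
      map_add' := fun f g => rfl
      map_smul' := fun r f => rfl }
  have hΦ : ∀ (f : τ.IntertwiningMap σ) (x : MonoidAlgebra ℚ G) (hx : x * e ∈ I),
      f ⟨x * e, hx⟩ = σ.asAlgebraHom x (Φ f) := by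
    intro f x hx
    rw [show (⟨x * e, hx⟩ : I) = τ.asAlgebraHom x ⟨e, he⟩ by rw [hτ]; rfl,
      intertwiningMap_asAlgebraHom]
    rfl
  have hinj : Function.Injective Φ := by
    intro f g hfg
    ext ⟨m, hm⟩
    obtain ⟨x, rfl⟩ := Ideal.mem_span_singleton'.1 hm
    exact (hΦ f x hm).trans ((congrArg _ hfg).trans (hΦ g x hm).symm)
  have hrange : LinearMap.range Φ = LinearMap.range (σ.asAlgebraHom e) := by
    apply le_antisymm
    · rintro _ ⟨f, rfl⟩
      obtain ⟨r, hr⟩ := exists_eq_mul_mul e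
      have h1 : Φ f = f ⟨(e * r) * e, hr ▸ he⟩ := by
        change f _ = f _
        congr 2
      rw [h1, hΦ, map_mul]
      exact ⟨_, rfl⟩
    · rintro _ ⟨w, rfl⟩
      let f : τ.IntertwiningMap σ :=
        { toFun := fun m => σ.asAlgebraHom m.1 w
          map_add' := fun m m' => by simp
          map_smul' := fun r m => by simp
          isIntertwining' := fun g => by
            ext m
            have : τ g m = τ.asAlgebraHom (MonoidAlgebra.single g 1) m := by simp
            change σ.asAlgebraHom (τ g m).1 w = σ g (σ.asAlgebraHom m.1 w)
            rw [this, hτ]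
            simp }
      exact ⟨f, rfl⟩
  rw [← hrange]
  exact (LinearEquiv.ofInjective Φ hinj).finrank_eq

/-- The Young symmetrizer generating `V(lam)_n`. -/
abbrev paddedSymm (lam : List ℕ) (n : ℕ) : MonoidAlgebra ℚ (Equiv.Perm (Fin n)) :=
  youngSymmetrizer fun j : Fin n => box ((n - lam.sum) :: lam) j

lemma mult_eq (lam : List ℕ) (n : ℕ) (W : Rep.{u} ℚ (Equiv.Perm (Fin n))) :
    mult lam n W = Module.finrank ℚ (LinearMap.range (W.ρ.asAlgebraHom (paddedSymm lam n))) :=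
  finrank_intertwiningMap_span _ _

end Multiplicity

/-! ### Multiplicities in homology -/

section Exactness

variable {G : Type*} [Group G] [Fintype G]
  {V W : Type*} [AddCommGroup V] [Module ℚ V] [AddCommGroup W] [Module ℚ W]

/-- The subspace `e V` of a representation `V`, for an element `e` of the group algebra. -/
abbrev cut (ρ : Representation ℚ G V) (e : MonoidAlgebra ℚ G) : Submodule ℚ V :=
  LinearMap.range (ρ.asAlgebraHom e)

variable {ρ : Representation ℚ G V} {σ : Representation ℚ G W} (e : MonoidAlgebra ℚ G)

/-- Equivariant maps are strict for `V ↦ e V`; in other words, this functor is exact. -/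
lemma cut_inf_range (f : ρ.IntertwiningMap σ) :
    cut σ e ⊓ LinearMap.range f.toLinearMap = (cut ρ e).map f.toLinearMap := by
  apply le_antisymm
  · rintro _ ⟨⟨w, rfl⟩, ⟨v, hv⟩⟩
    obtain ⟨r, hr⟩ := exists_eq_mul_mul e
    refine ⟨ρ.asAlgebraHom e (ρ.asAlgebraHom r v), ⟨_, rfl⟩, ?_⟩
    have h1 : f v = σ.asAlgebraHom e w := hv
    change f _ = _
    rw [intertwiningMap_asAlgebraHom, intertwiningMap_asAlgebraHom, h1]
    conv_rhs => rw [hr]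
    simp
  · rintro _ ⟨_, ⟨v, rfl⟩, rfl⟩
    refine ⟨⟨f v, (intertwiningMap_asAlgebraHom f e v).symm⟩, ⟨_, rfl⟩⟩

lemma finrank_map_add_finrank_inf_ker [FiniteDimensional ℚ V] (E : Submodule ℚ V) (f : V →ₗ[ℚ] W) :
    Module.finrank ℚ (E.map f) + Module.finrank ℚ (E ⊓ LinearMap.ker f : Submodule ℚ V) =
      Module.finrank ℚ E := by
  have h := LinearMap.finrank_range_add_finrank_ker (f.domRestrict E)
  rw [LinearMap.range_domRestrict] at h
  rw [← h, LinearMap.ker_domRestrict, ← Submodule.map_comap_subtype,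
    (Submodule.equivSubtypeMap E _).finrank_eq]

lemma rep_exact_apply {G : Type} [Group G] {S : ShortComplex (Rep.{u} ℚ G)} (hS : S.Exact)
    (x : S.X₂) (hx : S.g.hom x = 0) : ∃ y, S.f.hom y = x := by
  have h := (ShortComplex.exact_map_iff_of_faithful S (forget₂ (Rep.{u} ℚ G) (ModuleCat ℚ))).2 hS
  exact (ShortComplex.moduleCat_exact_iff _).1 h x hx

/-- The dimension of `e H` for the homology `H` of a complex, in terms of the dimension of `e X` for
its term `X` in the same degree and the ranks of the two adjacent differentials. -/
theorem finrank_cut_homology {G : Type} [Group G] [Fintype G] (K : ChainComplex (Rep.{u} ℚ G) ℤ)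
    [∀ i, FiniteDimensional ℚ (K.X i)] (e : MonoidAlgebra ℚ G) (i : ℤ) :
    Module.finrank ℚ (cut (K.homology i).ρ e) +
      Module.finrank ℚ ((cut (K.X (i + 1)).ρ e).map (K.d (i + 1) i).hom.toLinearMap) +
      Module.finrank ℚ ((cut (K.X i).ρ e).map (K.d i (i - 1)).hom.toLinearMap) =
    Module.finrank ℚ (cut (K.X i).ρ e) := by
  set ι := (K.iCycles i).hom with hι
  set π := (K.homologyπ i).hom with hπ
  set p := (K.toCycles (i + 1) i).hom with hp
  set d := (K.d i (i - 1)).hom with hd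
  have hιinj : Function.Injective ι := (Rep.mono_iff_injective (K.iCycles i)).1 inferInstance
  have hπsurj : Function.Surjective π := (Rep.epi_iff_surjective (K.homologyπ i)).1 inferInstance
  have hιd : LinearMap.range ι.toLinearMap = LinearMap.ker d.toLinearMap := by
    have hex : (ShortComplex.mk (K.iCycles i) (K.d i (i - 1)) (K.iCycles_d i (i - 1))).Exact :=
      ShortComplex.exact_of_f_is_kernel _ (K.cyclesIsKernel i (i - 1) (ChainComplex.next ℤ i))
    apply le_antisymm
    · rintro _ ⟨z, rfl⟩
      exact congr(($(K.iCycles_d i (i - 1))).hom z)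
    · intro x hx
      exact rep_exact_apply hex x hx
  have hpπ : LinearMap.range p.toLinearMap = LinearMap.ker π.toLinearMap := by
    have hex : (ShortComplex.mk (K.toCycles (i + 1) i) (K.homologyπ i)
        (K.toCycles_comp_homologyπ (i + 1) i)).Exact :=
      ShortComplex.exact_of_g_is_cokernel _
        (K.homologyIsCokernel (i + 1) i (ChainComplex.prev ℤ i))
    apply le_antisymm
    · rintro _ ⟨z, rfl⟩
      exact congr(($(K.toCycles_comp_homologyπ (i + 1) i)).hom z)
    · intro x hx
      exact rep_exact_apply hex x hx
  have hpι : (K.d (i + 1) i).hom.toLinearMap = ι.toLinearMap ∘ₗ p.toLinearMap := by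
    rw [← K.toCycles_i (i + 1) i]
    rfl
  have hfin : FiniteDimensional ℚ (K.cycles i) :=
    FiniteDimensional.of_injective ι.toLinearMap hιinj
  have h1 := finrank_map_add_finrank_inf_ker (cut (K.cycles i).ρ e) π.toLinearMap
  have h2 := finrank_map_add_finrank_inf_ker (cut (K.X i).ρ e) d.toLinearMap
  rw [← hpπ, cut_inf_range] at h1
  rw [← hιd, cut_inf_range] at h2
  have h3 : (cut (K.cycles i).ρ e).map π.toLinearMap = cut (K.homology i).ρ e := by
    rw [← cut_inf_range, LinearMap.range_eq_top.2 hπsurj, inf_top_eq]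
  have h4 : ∀ E : Submodule ℚ (K.cycles i),
      Module.finrank ℚ (E.map ι.toLinearMap) = Module.finrank ℚ E := fun E =>
    (Submodule.equivMapOfInjective _ hιinj E).finrank_eq.symm
  rw [h3] at h1
  rw [h4] at h2
  rw [hpι, Submodule.map_comp, h4]
  omega

end Exactness

/-! ### Passing from the symmetric group on n letters to the next one -/

section Transfer

lemma asAlgebraHom_youngSymmetrizer {α : Type} [Fintype α] [DecidableEq α] {V : Type*}
    [AddCommGroup V] [Module ℚ V] (ρ : Representation ℚ (Equiv.Perm α) V) (T : α → ℕ × ℕ) (w : V) :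
    ρ.asAlgebraHom (youngSymmetrizer T) w = rowSum ρ T ∅ (colSum ρ T ∅ w) := by
  rw [youngSymmetrizer, map_mul, Module.End.mul_apply, stabSum_apply, stabSum_apply, map_sum,
    map_sum, LinearMap.sum_apply, LinearMap.sum_apply]
  have hfil : ∀ c : α → ℕ, (Finset.univ.filter fun g : Equiv.Perm α => ∀ j, c (g j) = c j) =
      colorStab c ∅ := fun c => by ext g; simp [mem_colorStab]
  rw [← hfil, ← hfil]
  simp [Representation.asAlgebraHom_single]

/-- The Young symmetrizers of all tableaux of one shape are conjugate. -/
lemma rowSum_colSum_comp {α : Type} [Fintype α] [DecidableEq α] {V : Type*}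
    [AddCommGroup V] [Module ℚ V] (ρ : Representation ℚ (Equiv.Perm α) V) (T : α → ℕ × ℕ)
    (σ : Equiv.Perm α) (w : V) :
    rowSum ρ (fun x => T (σ x)) ∅ (colSum ρ (fun x => T (σ x)) ∅ w) =
      ρ σ⁻¹ (rowSum ρ T ∅ (colSum ρ T ∅ (ρ σ w))) := by
  rw [rowSum, colSum, stabSum_comp (c := fun x => (T x).1), stabSum_comp (c := fun x => (T x).2),
    Representation.self_inv_apply]

lemma IsTableau.exists_perm {n : ℕ} {lam : List ℕ} {T : Fin n → ℕ × ℕ} (hT : IsTableau lam T) :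
    ∃ σ : Equiv.Perm (Fin n), T = fun x => box lam (σ x) := by
  have hn : lam.sum = n := by simpa using hT.card_eq.symm
  obtain ⟨e, he⟩ := hT
  exact ⟨e.trans (finCongr hn), funext fun x => by rw [he]; rfl⟩

/-- The tableau of shape `(a + 1, lam)` obtained from the row by row tableau of shape `(a, lam)` by
putting the new last label at the end of the first row. -/
def extTableau (a : ℕ) (lam : List ℕ) (n : ℕ) : Fin (n + 1) → ℕ × ℕ :=
  Fin.lastCases (0, a) fun j => box (a :: lam) j

lemma isTableau_extTableau {a n : ℕ} {lam : List ℕ} (h : a + lam.sum = n) :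
    IsTableau ((a + 1) :: lam) (extTableau a lam n) := by
  subst h
  let f : Fin (a + lam.sum + 1) → Fin ((a + 1) + lam.sum) :=
    Fin.lastCases ⟨a, by omega⟩ fun j =>
      if (j : ℕ) < a then ⟨j, by omega⟩ else ⟨j + 1, by omega⟩
  have hlast : f (Fin.last _) = ⟨a, by omega⟩ := Fin.lastCases_last
  have hcast : ∀ j : Fin (a + lam.sum), f j.castSucc =
      if (j : ℕ) < a then ⟨j, by omega⟩ else ⟨j + 1, by omega⟩ := fun j => Fin.lastCases_castSucc _
  have hinj : Function.Injective f := by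
    intro x y hxy
    induction x using Fin.lastCases with
    | last =>
      induction y using Fin.lastCases with
      | last => rfl
      | cast j =>
        rw [hlast, hcast] at hxy
        split_ifs at hxy <;> simp only [Fin.mk.injEq] at hxy <;> omega
    | cast i =>
      induction y using Fin.lastCases with
      | last =>
        rw [hlast, hcast] at hxy
        split_ifs at hxy <;> simp only [Fin.mk.injEq] at hxy <;> omega
      | cast j =>
        rw [hcast, hcast] at hxy
        have : (i : ℕ) = j := by
          split_ifs at hxy <;> simp only [Fin.mk.injEq] at hxy <;> omega
        rw [Fin.ext this]
  have hbij : Function.Bijective f :=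
    (Fintype.bijective_iff_injective_and_card f).2 ⟨hinj, by simp; omega⟩
  refine ⟨Equiv.ofBijective f hbij, fun x => ?_⟩
  change extTableau a lam _ x = box ((a + 1) :: lam) (f x)
  induction x using Fin.lastCases with
  | last => rw [hlast, box_cons_of_lt lam (Nat.lt_succ_self a)]; exact Fin.lastCases_last
  | cast j =>
    rw [hcast, show extTableau a lam _ j.castSucc = box (a :: lam) j from Fin.lastCases_castSucc _]
    split_ifs with hj
    · rw [box_cons_of_lt lam hj, box_cons_of_lt lam (hj.trans (Nat.lt_succ_self a))]
    · obtain ⟨k, hk⟩ := Nat.exists_eq_add_of_le (not_lt.1 hj)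
      change box (a :: lam) (j : ℕ) = box ((a + 1) :: lam) ((j : ℕ) + 1)
      rw [hk, box_cons_add, show a + k + 1 = (a + 1) + k by omega, box_cons_add]

lemma paddedSymm_eq {lam : List ℕ} {n a : ℕ} (h : n - lam.sum = a) :
    paddedSymm lam n = youngSymmetrizer fun j : Fin n => box (a :: lam) j := by
  subst h; rfl

/-- There is an element `t` of the group algebra of `S_{n+1}` which carries the image of the Young
symmetrizer of `V(lam)_n` into that of `V(lam)_{n+1}`, and which does so injectively on
representations that contain no `V(κ)_{n+1}` with `|κ| = |lam| + 1` and `κ_1 ≥ lam_1`. -/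
theorem exists_transfer {lam : List ℕ} (hlam : IsPartition lam) {n : ℕ}
    (hn : lam.sum + lam.headD 0 ≤ n) :
    ∃ t : MonoidAlgebra ℚ (Equiv.Perm (Fin (n + 1))), ∀ (V : Type u) [AddCommGroup V] [Module ℚ V]
      [FiniteDimensional ℚ V] (ρ : Representation ℚ (Equiv.Perm (Fin (n + 1))) V),
      (∀ w ∈ cut (resEmb Fin.castSuccEmb ρ) (paddedSymm lam n),
        ρ.asAlgebraHom t w ∈ cut ρ (paddedSymm lam (n + 1))) ∧
      ((∀ κ : List ℕ, IsPartition κ → κ.sum = lam.sum + 1 → lam.headD 0 ≤ κ.headD 0 →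
        κ.sum + κ.headD 0 ≤ n + 1 → ∀ u, ρ.asAlgebraHom (paddedSymm κ (n + 1)) u = 0) →
      ∀ w ∈ cut (resEmb Fin.castSuccEmb ρ) (paddedSymm lam n),
        ρ.asAlgebraHom t w = 0 → w = 0) := by
  obtain ⟨a, ha⟩ : ∃ a, n - lam.sum = a := ⟨_, rfl⟩
  have han : a + lam.sum = n := by omega
  have hla : lam.headD 0 ≤ a := by omega
  set T := extTableau a lam n with hTdef
  have hT : IsTableau ((a + 1) :: lam) T := isTableau_extTableau han
  have hz : T (Fin.last n) = (0, a) := Fin.lastCases_last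
  obtain ⟨σ, hσ⟩ := hT.exists_perm
  let Y : Finset (Fin (n + 1)) := Finset.univ.filter fun y =>
    (T y).1 = (T (Fin.last n)).1 ∧ y ∉ (∅ : Finset (Fin (n + 1)))
  -- coset representatives enlarging the row group by the last label, then the relabelling `σ`
  refine ⟨MonoidAlgebra.single σ 1 * ∑ y ∈ Y, MonoidAlgebra.single (Equiv.swap (Fin.last n) y) 1,
    fun V _ _ _ ρ => ?_⟩
  have hS : ∀ x, x ∈ ({Fin.last n} : Finset (Fin (n + 1))) ↔
      x ∉ Set.range (Fin.castSuccEmb : Fin n ↪ Fin (n + 1)) := by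
    intro x
    induction x using Fin.lastCases with
    | last => simp
    | cast j => simp [Fin.castSucc_ne_last]
  have hTc : ∀ j : Fin n, T (Fin.castSuccEmb j) = box (a :: lam) j := fun j =>
    Fin.lastCases_castSucc _
  -- the last label is alone in its column
  have hcolstab : colorStab (fun x => (T x).2) {Fin.last n} = colorStab (fun x => (T x).2) ∅ := by
    apply (colorStab_mono (Finset.empty_subset _)).antisymm
    intro g hg
    rw [mem_colorStab] at hg ⊢
    refine ⟨hg.1, fun s hs => ?_⟩
    rw [Finset.mem_singleton.1 hs]
    by_contra hne
    have := hT.col_lt_of_ne hlam hla hz hne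
    rw [hg.1, hz] at this
    exact lt_irrefl _ this
  have hcut : ∀ w, Representation.asAlgebraHom (resEmb Fin.castSuccEmb ρ)
      (paddedSymm lam n) w = rowSum ρ T {Fin.last n} (colSum ρ T ∅ w) := by
    intro w
    rw [paddedSymm_eq ha, asAlgebraHom_youngSymmetrizer]
    have h1 : ∀ v, rowSum (resEmb Fin.castSuccEmb ρ) (fun j : Fin n => box (a :: lam) j) ∅ v =
        rowSum ρ T {Fin.last n} v := fun v =>
      stabSum_embedding ρ Fin.castSuccEmb (fun _ => rfl) (fun x y => by rw [hTc, hTc]) hS v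
    have h2 : ∀ v, colSum (resEmb Fin.castSuccEmb ρ) (fun j : Fin n => box (a :: lam) j) ∅ v =
        colSum ρ T {Fin.last n} v := fun v =>
      stabSum_embedding ρ Fin.castSuccEmb (sign_viaEmbeddingHom _)
        (fun x y => by rw [hTc, hTc]) hS v
    refine (h1 _).trans (congrArg _ ((h2 w).trans ?_))
    rw [colSum, stabSum_apply, hcolstab, ← stabSum_apply]
  have ht : ∀ w, ρ.asAlgebraHom (MonoidAlgebra.single σ 1 *
      ∑ y ∈ Y, MonoidAlgebra.single (Equiv.swap (Fin.last n) y) 1)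
        (rowSum ρ T {Fin.last n} (colSum ρ T ∅ w)) =
      ρ σ (rowSum ρ T ∅ (colSum ρ T ∅ w)) := by
    intro w
    rw [map_mul, Module.End.mul_apply, map_sum, LinearMap.sum_apply,
      Representation.asAlgebraHom_single, one_smul, rowSum,
      stabSum_peel (S := ∅) (c := fun x => (T x).1) (x := Fin.last n) (by simp)]
    congr 1
    refine Finset.sum_congr rfl fun y _ => ?_
    simp [Representation.asAlgebraHom_single]
  constructor
  · rintro _ ⟨w, rfl⟩
    refine ⟨ρ σ w, ?_⟩
    rw [hcut, ht, paddedSymm_eq (show n + 1 - lam.sum = a + 1 by omega),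
      asAlgebraHom_youngSymmetrizer, hσ,
      rowSum_colSum_comp ρ (fun j : Fin (n + 1) => box ((a + 1) :: lam) j) σ,
      Representation.self_inv_apply]
  · rintro hvan _ ⟨w, rfl⟩ h0
    rw [hcut, ht] at h0
    rw [hcut]
    obtain ⟨B, hB⟩ := exists_isInvariantInner ρ
    refine rowSum_colSum_eq_zero hB hlam hla hT hz ?_
      ((map_eq_zero_iff _ (ρ.apply_bijective σ).1).1 h0)
    intro κ hκ hsum hge hle T' hT' u
    obtain ⟨σ', rfl⟩ := hT'.exists_perm
    have := hvan κ hκ hsum hge (by omega) (ρ σ' u)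
    rw [paddedSymm_eq (show n + 1 - κ.sum = a by omega), asAlgebraHom_youngSymmetrizer] at this
    rw [rowSum_colSum_comp ρ (fun j : Fin (n + 1) => box (a :: κ) j) σ', this, map_zero]

end Transfer

/-! ### Stable sequences and complexes -/

section Stability

/-- Beyond the range of stability, the multiplicity of `V(κ)_n` vanishes. -/
lemma ConsistentSequence.StableAt.mult_eq_zero {A : ConsistentSequence.{u}} {N : ℕ}
    (hA : A.StableAt N) {κ : List ℕ} (hκ : IsPartition κ) (hN : N < κ.sum + κ.headD 0)
    (hpos : 0 < κ.sum) (n : ℕ) (hn : κ.sum + κ.headD 0 ≤ n) : mult κ n (A.obj n) = 0 := by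
  have h1 : 1 ≤ κ.headD 0 := by
    cases κ with
    | nil => simp at hpos
    | cons b l => exact hκ.2 b List.mem_cons_self
  induction n with
  | zero => omega
  | succ n IH =>
    rw [(hA n (by omega) (by omega)).2.2 κ hκ hn]
    split_ifs with h
    · exact IH h
    · rfl

variable {A : ConsistentComplex.{u}} {N : ℕ} {lam : List ℕ}

/-- For `|lam| + lam_1 = N` the ranks of the differentials on the multiplicity spaces of `V(lam)_n`
do not change with `n`. -/
lemma finrank_map_d_succ (hA : A.StableAt N) (hlam : IsPartition lam)
    (hN : lam.sum + lam.headD 0 = N) {n : ℕ} (hn : 1 ≤ n) (hNn : N ≤ n) (i j : ℤ) :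
    Module.finrank ℚ ((cut ((A.obj (n + 1)).X i).ρ (paddedSymm lam (n + 1))).map
      ((A.obj (n + 1)).d i j).hom.toLinearMap) =
    Module.finrank ℚ ((cut ((A.obj n).X i).ρ (paddedSymm lam n)).map
      ((A.obj n).d i j).hom.toLinearMap) := by
  obtain ⟨t, ht⟩ := exists_transfer.{u} hlam (hN.trans_le hNn)
  have hfin : ∀ n i, FiniteDimensional ℚ ((A.obj n).X i) := A.finiteDimensional
  let φ : ∀ i : ℤ, ((A.obj n).X i).ρ.IntertwiningMap
      (resEmb Fin.castSuccEmb ((A.obj (n + 1)).X i).ρ) := fun i => ((A.map n).f i).hom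
  let Ψ : ∀ i : ℤ, (A.obj n).X i →ₗ[ℚ] (A.obj (n + 1)).X i := fun i =>
    (((A.obj (n + 1)).X i).ρ.asAlgebraHom t) ∘ₗ (φ i).toLinearMap
  have hφ : ∀ i, ∀ w ∈ cut ((A.obj n).X i).ρ (paddedSymm lam n), φ i w ∈
      cut (resEmb Fin.castSuccEmb ((A.obj (n + 1)).X i).ρ)
        (paddedSymm lam n) := by
    rintro i _ ⟨w, rfl⟩
    exact ⟨φ i w, (intertwiningMap_asAlgebraHom (φ i) _ w).symm⟩
  have hinj : ∀ i, ∀ w ∈ cut ((A.obj n).X i).ρ (paddedSymm lam n), Ψ i w = 0 → w = 0 := by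
    intro i w hw h0
    have h1 := (ht _ ((A.obj (n + 1)).X i).ρ).2 (by
      intro κ hκ hsum hge hle v
      have h2 := (hA i).mult_eq_zero hκ (by omega) (by omega) (n + 1) hle
      have : FiniteDimensional ℚ ((A.degree i).obj (n + 1)) := hfin (n + 1) i
      rw [mult_eq, Submodule.finrank_eq_zero, LinearMap.range_eq_bot] at h2
      exact LinearMap.congr_fun h2 v) _ (hφ i w hw) h0
    exact (hA i n hn hNn).1 (h1.trans (map_zero (φ i)).symm)
  have hmap : ∀ i, (cut ((A.obj n).X i).ρ (paddedSymm lam n)).map (Ψ i) =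
      cut ((A.obj (n + 1)).X i).ρ (paddedSymm lam (n + 1)) := by
    intro i
    refine Submodule.eq_of_le_of_finrank_eq ?_ ?_
    · rintro _ ⟨w, hw, rfl⟩
      exact (ht _ _).1 _ (hφ i w hw)
    · have h1 := finrank_map_add_finrank_inf_ker (cut ((A.obj n).X i).ρ (paddedSymm lam n)) (Ψ i)
      have h2 : cut ((A.obj n).X i).ρ (paddedSymm lam n) ⊓ LinearMap.ker (Ψ i) = ⊥ :=
        (Submodule.eq_bot_iff _).2 fun w hw => hinj i w hw.1 hw.2
      rw [h2, finrank_bot, add_zero] at h1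
      have h3 := (hA i n hn hNn).2.2 lam hlam (by omega)
      rw [if_pos (by omega), mult_eq, mult_eq] at h3
      exact h1.trans h3.symm
  have hcomm : ((A.obj (n + 1)).d i j).hom.toLinearMap ∘ₗ Ψ i =
      Ψ j ∘ₗ ((A.obj n).d i j).hom.toLinearMap := by
    ext w
    have h1 : ((A.obj (n + 1)).d i j).hom (φ i w) = φ j (((A.obj n).d i j).hom w) :=
      congr(($((A.map n).comm i j)).hom w)
    change ((A.obj (n + 1)).d i j).hom (((A.obj (n + 1)).X i).ρ.asAlgebraHom t (φ i w)) =
      ((A.obj (n + 1)).X j).ρ.asAlgebraHom t (φ j (((A.obj n).d i j).hom w))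
    rw [← h1]
    exact intertwiningMap_asAlgebraHom _ t _
  rw [← hmap, ← Submodule.map_comp, hcomm, Submodule.map_comp]
  have h1 := finrank_map_add_finrank_inf_ker ((cut ((A.obj n).X i).ρ (paddedSymm lam n)).map
    ((A.obj n).d i j).hom.toLinearMap) (Ψ j)
  have h2 : (cut ((A.obj n).X i).ρ (paddedSymm lam n)).map ((A.obj n).d i j).hom.toLinearMap ⊓
      LinearMap.ker (Ψ j) = ⊥ := by
    refine (Submodule.eq_bot_iff _).2 fun w hw => hinj j w ?_ hw.2
    have h3 := hw.1
    rw [← cut_inf_range] at h3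
    exact h3.1
  rwa [h2, finrank_bot, add_zero] at h1

theorem mult_homology_succ (hA : A.StableAt N) (hlam : IsPartition lam)
    (hN : lam.sum + lam.headD 0 = N) {n : ℕ} (hn : 1 ≤ n) (hNn : N ≤ n) (i : ℤ) :
    mult lam (n + 1) ((A.obj (n + 1)).homology i) = mult lam n ((A.obj n).homology i) := by
  have hfin : ∀ n i, FiniteDimensional ℚ ((A.obj n).X i) := A.finiteDimensional
  have h1 := finrank_cut_homology (A.obj n) (paddedSymm lam n) i
  have h2 := finrank_cut_homology (A.obj (n + 1)) (paddedSymm lam (n + 1)) i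
  have h3 : mult lam (n + 1) ((A.obj (n + 1)).X i) =
      if lam.sum + lam.headD 0 ≤ n then mult lam n ((A.obj n).X i) else 0 :=
    (hA i n hn hNn).2.2 lam hlam (by omega)
  rw [if_pos (by omega)] at h3
  rw [finrank_map_d_succ hA hlam hN hn hNn, finrank_map_d_succ hA hlam hN hn hNn] at h2
  rw [← mult_eq, ← mult_eq] at h1 h2
  omega

end Stability

end RepStab

end
theorem mainTheorem2 (A : RepStab.ConsistentComplex.{u}) (N : ℕ) (hA : A.StabilizesSharplyAt N)
    (lam : List ℕ) (hlam : RepStab.IsPartition lam) (hN : lam.sum + lam.headD 0 = N)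
    (i : ℤ) (m n : ℕ) (hm : 1 ≤ m) (hNm : N ≤ m) (hn : 1 ≤ n) (hNn : N ≤ n) :
    RepStab.mult lam m ((A.obj m).homology i) = RepStab.mult lam n ((A.obj n).homology i) := by
  have key : ∀ k, max N 1 ≤ k → RepStab.mult lam k ((A.obj k).homology i) =
      RepStab.mult lam (max N 1) ((A.obj (max N 1)).homology i) := by
    intro k hk
    induction k, hk using Nat.le_induction with
    | base => rfl
    | succ k hk IH =>
      rw [RepStab.mult_homology_succ hA.1 hlam hN (by omega) (by omega), IH]
  rw [key m (by omega), key n (by omega)]
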